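/- Let $H$ be a real Hilbert space and let $\Phi:H\to\mathbb R\cup\{\pm\infty\}$ be proper, convex and lower semicontinuous with $\operatorname{argmin}\Phi\neq\emptyset$; let $x^*$ be the element of minimal norm of $\operatorname{argmin}\Phi$. For $\lambda>0$ let $\Phi_\lambda(x)=\inf_{y\in H}\{\Phi(y)+\frac1{2\lambda}\|x-y\|^2\}$ be the Moreau envelope, and for $\varepsilon>0$ let $\varphi_{\varepsilon,\lambda}(x)=\Phi_\lambda(x)+\frac{\varepsilon}{2}\|x\|^2$, with unique minimizer $x_{\varepsilon,\lambda}$. Let $\alpha,\beta,t_0>0$, let $\lambda:[t_0,\infty)\to(0,\infty)$ be $C^1$ and nondecreasing, and let $\varepsilon:[t_0,\infty)\to(0,\infty)$ be $C^1$ and nonincreasing with $\varepsilon(t)\to0$ as $t\to\infty$. Let $x:[t_0,\infty)\to H$ be a strong global solution of $$\ddot x(t)+\alpha\sqrt{\varepsilon(t)}\,\dot x(t)+\beta\frac{d}{dt}\big(\nabla\Phi_{\lambda(t)}(x(t))\big)+\nabla\Phi_{\lambda(t)}(x(t))+\varepsilon(t)x(t)=0,$$ that is, $x$ is differentiable, $\dot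 x$ and $t\mapsto\nabla\Phi_{\lambda(t)}(x(t))$ are locally absolutely continuous on $[t_0,\infty)$, and the equation holds for almost every $t\ge t_0$. Let $\frac\alpha2\le\gamma<\alpha$ and $$E(t)=\varphi_{\varepsilon(t),\lambda(t)}(x(t))-\varphi_{\varepsilon(t),\lambda(t)}(x_{\varepsilon(t),\lambda(t)})+\tfrac12\big\|\gamma\sqrt{\varepsilon(t)}\,(x(t)-x_{\varepsilon(t),\lambda(t)})+\dot x(t)+\beta\nabla\Phi_{\lambda(t)}(x(t))\big\|^2 .$$ Assume that $\lambda(t)\varepsilon(t)\to0$ as $t\to\infty$ and that there are $a,c>0$ such that for all sufficiently large $t$ $$\frac{d}{dt}\frac1{\sqrt{\varepsilon(t)}}\le\min\Big\{2\gamma-\alpha-\frac{\gamma\beta\dot\varepsilon(t)}{2\varepsilon(t)},\ \alpha-\gamma\frac{a+1}{a}\Big\},$$ $$\Big(2\gamma(\alpha-\gamma)+\frac\gamma c-1\Big)\varepsilon(t)-\beta\dot\varepsilon(t)\le0,\qquad 2\beta\varepsilon^2(t)+\big(2-\gamma\beta\sqrt{\varepsilon(t)}\big)\dot\varepsilon(t)\le0,$$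 $$\Big(\frac\gamma a+2(\alpha-\gamma)\Big)\beta^2\sqrt{\varepsilon(t)}-\frac{3\beta^2\dot\varepsilon(t)}{2\varepsilon(t)}-\dot\lambda(t)\le\beta .$$ Then the following hold. 1. If $\dot\lambda(t)\varepsilon^{3/2}(t)\to0$ and $\dot\lambda(t)/\lambda(t)\to0$ as $t\to\infty$, then $E(t)\to0$. 2. If, for some $t_1\ge t_0$, as $t\to\infty$, $$\sqrt{\varepsilon(t)}\exp\Big((\alpha-\gamma)\int_{t_1}^t\sqrt{\varepsilon(s)}\,ds\Big)\to+\infty,\quad \frac{\dot\varepsilon(t)}{\varepsilon^{3/2}(t)}\to0,\quad \dot\lambda(t)\sqrt{\varepsilon(t)}\to0,\quad \frac{\dot\lambda(t)}{\lambda(t)\sqrt{\varepsilon(t)}}\to0,$$ then $E(t)/\varepsilon(t)\to0$, $x(t)\to x^*$ strongly in $H$, and $\lambda(t)E(t)\to0$ as $t\to\infty$. -/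

import Mathlib

open Set Filter Topology MeasureTheory

noncomputable section

section Objective

variable {H : Type*} [NormedAddCommGroup H]

/-- `Φ` is proper: it never takes the value `-∞` and is not identically `+∞`. -/
def IsProperFun (Φ : H → EReal) : Prop :=
  (∀ x, Φ x ≠ ⊥) ∧ ∃ x, Φ x ≠ ⊤

/-- An extended-real-valued function is convex if its epigraph is a convex subset of `H × ℝ`. -/
def IsConvexFun [NormedSpace ℝ H] (Φ : H → EReal) : Prop :=
  Convex ℝ {p : H × ℝ | Φ p.1 ≤ (p.2 : EReal)}

/-- The set of global minimizers of `Φ`. -/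
def argminSet (Φ : H → EReal) : Set H :=
  {x | ∀ y, Φ x ≤ Φ y}

/-- `z` is the projection of `0` onto `argmin Φ`, that is, the minimizer of least norm. -/
def IsMinNormMinimizer (Φ : H → EReal) (z : H) : Prop :=
  z ∈ argminSet Φ ∧ ∀ w ∈ argminSet Φ, ‖z‖ ≤ ‖w‖

/-- The Moreau envelope `Φ_l (x) = inf_y (Φ y + ‖x - y‖² / (2 l))` of index `l > 0`. For a proper
function that has a global minimizer the infimum is a real number. -/
def moreauEnvelope (Φ : H → EReal) (l : ℝ) (x : H) : ℝ :=
  (⨅ y : H, Φ y + ((‖x - y‖ ^ 2 / (2 * l) : ℝ) : EReal)).toReal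

/-- The regularized function `φ_{e,l} (x) = Φ_l (x) + e ‖x‖² / 2`. -/
def tikhonovFun (Φ : H → EReal) (e l : ℝ) (x : H) : ℝ :=
  moreauEnvelope Φ l x + e * ‖x‖ ^ 2 / 2

/-- The (unique) global minimizer `x_{e,l}` of `φ_{e,l}`. -/
def tikhonovPoint (Φ : H → EReal) (e l : ℝ) : H :=
  Classical.epsilon fun z => ∀ y, tikhonovFun Φ e l z ≤ tikhonovFun Φ e l y

end Objective

section Dynamics

/-- Derivative on the half-line `[t₀, +∞)`, one-sided at `t₀`. -/
def timeDeriv {F : Type*} [NormedAddCommGroup F] [NormedSpace ℝ F] (t₀ : ℝ) (f : ℝ → F) :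
    ℝ → F :=
  derivWithin f (Ici t₀)

/-- `f` is locally absolutely continuous on `[t₀, +∞)`: on every `[t₀, T]` it is the indefinite
integral of an integrable function. -/
def LocallyAC {F : Type*} [NormedAddCommGroup F] [NormedSpace ℝ F] (t₀ : ℝ) (f : ℝ → F) : Prop :=
  ∃ y : ℝ → F, (∀ T, t₀ ≤ T → IntervalIntegrable y volume t₀ T) ∧
    ∀ t, t₀ ≤ t → f t = f t₀ + ∫ s in t₀..t, y s

variable {H : Type*} [NormedAddCommGroup H] [InnerProductSpace ℝ H] [CompleteSpace H]

/-- `x` is a strong global solution on `[t₀, +∞)` of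
`x'' + α √ε(t) x' + β d/dt (∇Φ_{l(t)} (x)) + ∇Φ_{l(t)} (x) + ε(t) x = 0`: the velocity `x'` exists
everywhere, the two functions `x'` and `t ↦ ∇Φ_{l(t)} (x(t))` which are differentiated in the
equation are locally absolutely continuous, and the equation holds for almost every `t ≥ t₀`. -/
structure IsStrongSolution (Φ : H → EReal) (α β t₀ : ℝ) (lam eps : ℝ → ℝ) (x : ℝ → H) : Prop where
  differentiable : DifferentiableOn ℝ x (Ici t₀)
  velocity_ac : LocallyAC t₀ (timeDeriv t₀ x)
  gradient_ac : LocallyAC t₀ (fun t => gradient (moreauEnvelope Φ (lam t)) (x t))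
  equation : ∀ᵐ t ∂(volume.restrict (Ici t₀)),
    timeDeriv t₀ (timeDeriv t₀ x) t + (α * √(eps t)) • timeDeriv t₀ x t
      + β • timeDeriv t₀ (fun s => gradient (moreauEnvelope Φ (lam s)) (x s)) t
      + gradient (moreauEnvelope Φ (lam t)) (x t) + eps t • x t = 0

/-- The energy `E(t) = φ_{ε(t),l(t)} (x(t)) - φ_{ε(t),l(t)} (x_{ε(t),l(t)})
  + ½ ‖γ √ε(t) (x(t) - x_{ε(t),l(t)}) + x'(t) + β ∇Φ_{l(t)} (x(t))‖²`. -/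
def energy (Φ : H → EReal) (β γ t₀ : ℝ) (lam eps : ℝ → ℝ) (x : ℝ → H) (t : ℝ) : ℝ :=
  tikhonovFun Φ (eps t) (lam t) (x t)
    - tikhonovFun Φ (eps t) (lam t) (tikhonovPoint Φ (eps t) (lam t))
    + 1 / 2 * ‖(γ * √(eps t)) • (x t - tikhonovPoint Φ (eps t) (lam t)) + timeDeriv t₀ x t
        + β • gradient (moreauEnvelope Φ (lam t)) (x t)‖ ^ 2

end Dynamics

end

/-! Write s = √ε, r = (1/√ε)', so that ε' = -2 r s³, and let z be the regularized minimizer. The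
core is a dissipation inequality valid at almost every large time, E' + s (r + α - γ) E ≤ s³ F, with
F (`forcing`) built from r, λ' s and λ ε; this is `TikhonovFlow.ae_deriv_energy_add_le`. The factor
of E is the logarithmic derivative of Γ = exp((α - γ) ∫ √ε) / √ε, so a supersolution ψ gives E ≤ ψ +
C / Γ (`TikhonovFlow.energy_le_of_supersolution`). For the first conclusion ψ = δ works, because ε F
→ 0 and Γ → ∞. For the second ψ = δ ε works, because F and r tend to 0 and Γ ε → ∞. Here δ > 0 is
arbitrary. Quadratic growth, ε/2 ‖x - z‖² ≤ E, then gives x - z → 0, and λ E = (λ ε)(E / ε).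

The point z is explicit: z = P(1/ε + λ) / (1 + λ ε), where P(τ) is the proximal point of 0 with
index τ. Monotonicity of the subdifferential makes P locally Lipschitz in τ, which bounds the speed
of z, and makes ‖P(τ)‖ nondecreasing and bounded, which forces P(τ) to converge to the minimizer of
least norm.

Neither z nor the envelope value need be differentiable in time at a given instant. The energy is
only shown to be absolutely continuous; its forward difference quotients are bounded by convexity
inequalities, and the limit is taken in these bounds (`TikhonovFlow.deriv_energy_le`). What remains
is the quadratic estimate `energy_rate_scalar`, in which the smallness of √ε lets -β ‖∇Φ_λ(x)‖²
absorb the gradient terms. -/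

/-! ### Proximal points and differentiability of the Moreau envelope. -/

section ProximalPoints

variable {H : Type*} [NormedAddCommGroup H] [InnerProductSpace ℝ H]

/-- `p` is the proximal point of `x` with index `l`: the vector `(x - p) / l` is a subgradient of
`Φ` at `p`. -/
def IsProx (Φ : H → EReal) (l : ℝ) (x p : H) : Prop :=
  ∃ f : ℝ, Φ p = f ∧ ∀ (q : H) (r : ℝ), Φ q ≤ r → f + 1 / l * inner ℝ (x - p) (q - p) ≤ r

theorem midpoint_penalty (x u v : H) (κ : ℝ) :
    κ * ‖x - ((1 / 2 : ℝ) • u + (1 / 2 : ℝ) • v)‖ ^ 2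
      = 1 / 2 * (κ * ‖x - u‖ ^ 2) + 1 / 2 * (κ * ‖x - v‖ ^ 2) - κ / 4 * ‖u - v‖ ^ 2 := by
  have h1 : x - ((1 / 2 : ℝ) • u + (1 / 2 : ℝ) • v)
      = (1 / 2 : ℝ) • (x - u) + (1 / 2 : ℝ) • (x - v) := by module
  have h2 : u - v = (x - v) - (x - u) := by abel
  rw [h1, h2, norm_add_sq_real, norm_sub_sq_real (x - v) (x - u), norm_smul, norm_smul,
    real_inner_smul_left, real_inner_smul_right, real_inner_comm (x - u) (x - v)]
  norm_num
  ring

/-- Direct method for Φ + κ‖x - ·‖²: the midpoint identity makes minimizing sequences Cauchy, lower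
semicontinuity shows that the limit is optimal, and first-order optimality is the subgradient
inequality. -/
theorem exists_isProx [CompleteSpace H] {Φ : H → EReal} (hproper : IsProperFun Φ)
    (hconv : IsConvexFun Φ) (hlsc : LowerSemicontinuous Φ) (hargmin : (argminSet Φ).Nonempty)
    {l : ℝ} (hl : 0 < l) (x : H) : ∃ p, IsProx Φ l x p := by
  obtain ⟨w, hw⟩ := hargmin
  obtain ⟨hbot, x₀, hx₀⟩ := hproper
  have hwtop : Φ w ≠ ⊤ := fun h => hx₀ (top_le_iff.1 (h ▸ hw x₀))
  obtain ⟨m, hm⟩ : ∃ m : ℝ, Φ w = m := ⟨_, (EReal.coe_toReal hwtop (hbot w)).symm⟩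
  set κ : ℝ := 1 / (2 * l) with hκ
  have hκ0 : 0 < κ := by positivity
  let S : Set ℝ := {s | ∃ (q : H) (r : ℝ), Φ q ≤ r ∧ s = r + κ * ‖x - q‖ ^ 2}
  have hSne : S.Nonempty := ⟨_, w, m, hm.le, rfl⟩
  have hSbdd : BddBelow S := by
    refine ⟨m, ?_⟩
    rintro s ⟨q, r, hq, rfl⟩
    have : (m : EReal) ≤ r := hm ▸ (hw q).trans hq
    have : m ≤ r := by exact_mod_cast this
    nlinarith [mul_nonneg hκ0.le (sq_nonneg ‖x - q‖)]
  set I := sInf S with hI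
  have hIle : ∀ (q : H) (r : ℝ), Φ q ≤ r → I ≤ r + κ * ‖x - q‖ ^ 2 :=
    fun q r h => csInf_le hSbdd ⟨q, r, h, rfl⟩
  have hseq : ∀ n : ℕ, ∃ q : H, ∃ r : ℝ, Φ q ≤ r ∧
      r + κ * ‖x - q‖ ^ 2 < I + 1 / ((n : ℝ) + 1) := by
    intro n
    have : I < I + 1 / ((n : ℝ) + 1) := by
      have : (0 : ℝ) < 1 / ((n : ℝ) + 1) := by positivity
      linarith
    obtain ⟨s, ⟨q, r, h, rfl⟩, hs⟩ := exists_lt_of_csInf_lt hSne this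
    exact ⟨q, r, h, hs⟩
  choose q r hqr hlt using hseq
  have hlim0 : Tendsto (fun n : ℕ => 1 / ((n : ℝ) + 1)) atTop (𝓝 0) :=
    tendsto_one_div_add_atTop_nhds_zero_nat
  have hcauchy : CauchySeq q := by
    refine cauchySeq_of_le_tendsto_0 (fun n : ℕ => √(4 / κ * (1 / ((n : ℝ) + 1)))) ?_ ?_
    · intro n k N hn hk
      rw [dist_eq_norm]
      apply Real.le_sqrt_of_sq_le
      have hmid : Φ ((1 / 2 : ℝ) • q n + (1 / 2 : ℝ) • q k) ≤
          ((1 / 2 * r n + 1 / 2 * r k : ℝ) : EReal) := by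
        have := @hconv (q n, r n) (hqr n) (q k, r k) (hqr k) (1 / 2) (1 / 2) (by norm_num)
          (by norm_num) (by norm_num)
        simpa using this
      have h1 := hIle _ _ hmid
      rw [midpoint_penalty] at h1
      have h2 := hlt n
      have h3 := hlt k
      have h4 : 1 / ((n : ℝ) + 1) ≤ 1 / ((N : ℝ) + 1) := by gcongr
      have h5 : 1 / ((k : ℝ) + 1) ≤ 1 / ((N : ℝ) + 1) := by gcongr
      have h6 : κ / 4 * ‖q n - q k‖ ^ 2 ≤ 1 / ((N : ℝ) + 1) := by linarith
      calc ‖q n - q k‖ ^ 2 = 4 / κ * (κ / 4 * ‖q n - q k‖ ^ 2) := by field_simp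
        _ ≤ _ := by gcongr
    · have := (hlim0.const_mul (4 / κ)).sqrt
      simpa using this
  obtain ⟨p, hp⟩ := cauchySeq_tendsto_of_complete hcauchy
  have hnorm : Tendsto (fun n => κ * ‖x - q n‖ ^ 2) atTop (𝓝 (κ * ‖x - p‖ ^ 2)) :=
    ((tendsto_const_nhds.sub hp).norm.pow 2).const_mul κ
  -- Otherwise a real c lies strictly between the two sides; lower semicontinuity puts c below Φ (q
  -- n) eventually, against the limit of the bounds on r n.
  have hΦp : Φ p ≤ ((I - κ * ‖x - p‖ ^ 2 : ℝ) : EReal) := by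
    by_contra! hcon
    obtain ⟨c, hc1, hc2⟩ := EReal.lt_iff_exists_real_btwn.1 hcon
    have hc1' : I - κ * ‖x - p‖ ^ 2 < c := by exact_mod_cast hc1
    have hev : ∀ᶠ n in atTop, (c : EReal) < Φ (q n) := hp.eventually (hlsc p c hc2)
    have hle : c ≤ I - κ * ‖x - p‖ ^ 2 := by
      have ht : Tendsto (fun n : ℕ => I + 1 / ((n : ℝ) + 1) - κ * ‖x - q n‖ ^ 2) atTop
          (𝓝 (I + 0 - κ * ‖x - p‖ ^ 2)) := (hlim0.const_add I).sub hnorm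
      rw [add_zero] at ht
      refine ge_of_tendsto ht ?_
      filter_upwards [hev] with n hn
      have : c < r n := by exact_mod_cast hn.trans_le (hqr n)
      linarith [hlt n]
    linarith
  have hptop : Φ p ≠ ⊤ := fun h => EReal.coe_ne_top _ (top_le_iff.1 (h ▸ hΦp))
  obtain ⟨f, hf⟩ : ∃ f : ℝ, Φ p = f := ⟨_, (EReal.coe_toReal hptop (hbot p)).symm⟩
  have hfI : f + κ * ‖x - p‖ ^ 2 ≤ I := by
    have : f ≤ I - κ * ‖x - p‖ ^ 2 := by exact_mod_cast hf ▸ hΦp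
    linarith
  refine ⟨p, f, hf, fun y ρ hy => ?_⟩
  -- Optimality of p is tested on the segment towards y; after division by θ, letting θ → 0 removes
  -- the quadratic term.
  have hθ : ∀ θ : ℝ, 0 < θ → θ < 1 →
      1 / l * inner ℝ (x - p) (y - p) ≤ ρ - f + θ * (κ * ‖y - p‖ ^ 2) := by
    intro θ h0 h1
    have hmid : Φ ((1 - θ) • p + θ • y) ≤ (((1 - θ) * f + θ * ρ : ℝ) : EReal) := by
      have := @hconv (p, f) hf.le (y, ρ) hy (1 - θ) θ (by linarith) h0.le (by ring)
      simpa using this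
    have h2 := hIle _ _ hmid
    have h3 : x - ((1 - θ) • p + θ • y) = (x - p) - θ • (y - p) := by module
    rw [h3, @norm_sub_sq_real, norm_smul, real_inner_smul_right, Real.norm_eq_abs,
      abs_of_pos h0] at h2
    have h4 : 1 / l = 2 * κ := by rw [hκ]; field_simp
    rw [h4]
    have h5 : θ * (2 * κ * inner ℝ (x - p) (y - p)) ≤
        θ * (ρ - f + θ * (κ * ‖y - p‖ ^ 2)) := by nlinarith
    exact le_of_mul_le_mul_left h5 h0
  have ht : Tendsto (fun θ : ℝ => ρ - f + θ * (κ * ‖y - p‖ ^ 2)) (𝓝[>] 0)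
      (𝓝 (ρ - f + 0 * (κ * ‖y - p‖ ^ 2))) :=
    ((tendsto_id.mono_left nhdsWithin_le_nhds).mul_const _).const_add _
  have := ge_of_tendsto ht (by
    filter_upwards [Ioo_mem_nhdsGT (zero_lt_one' ℝ)] with θ hh using hθ θ hh.1 hh.2)
  linarith

namespace IsProx

variable {Φ : H → EReal} {l : ℝ} {x p : H}

theorem moreauEnvelope_eq (hl : 0 < l) (h : IsProx Φ l x p) :
    moreauEnvelope Φ l x = (Φ p).toReal + ‖x - p‖ ^ 2 / (2 * l) := by
  obtain ⟨f, hf, hsub⟩ := h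
  have : (⨅ y : H, Φ y + ((‖x - y‖ ^ 2 / (2 * l) : ℝ) : EReal))
      = ((f + ‖x - p‖ ^ 2 / (2 * l) : ℝ) : EReal) := by
    apply le_antisymm
    · refine (iInf_le _ p).trans ?_
      rw [hf]
      norm_cast
    · refine le_iInf fun y => ?_
      rcases eq_or_ne (Φ y) ⊤ with hy | hy
      · simp [hy]
      -- At a point of value ⊥ the subgradient inequality could be applied with r one unit below its
      -- own affine lower bound.
      have hb : Φ y ≠ ⊥ := by
        intro hb
        have := hsub y (f + 1 / l * inner ℝ (x - p) (y - p) - 1) (by simp [hb])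
        linarith
      obtain ⟨r, hr⟩ : ∃ r : ℝ, Φ y = r := ⟨_, (EReal.coe_toReal hy hb).symm⟩
      have h1 := hsub y r hr.le
      have h2 : x - y = (x - p) - (y - p) := by abel
      have h3 : ‖x - p‖ ^ 2 / (2 * l) - 1 / l * inner ℝ (x - p) (y - p)
          ≤ ‖x - y‖ ^ 2 / (2 * l) := by
        rw [h2, norm_sub_sq_real (x - p) (y - p)]
        have : (‖x - p‖ ^ 2 - 2 * inner ℝ (x - p) (y - p) + ‖y - p‖ ^ 2) / (2 * l)
            = ‖x - p‖ ^ 2 / (2 * l) - 1 / l * inner ℝ (x - p) (y - p)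
              + ‖y - p‖ ^ 2 / (2 * l) := by field_simp
        rw [this]
        have : 0 ≤ ‖y - p‖ ^ 2 / (2 * l) := by positivity
        linarith
      rw [hr]
      norm_cast
      linarith
  rw [moreauEnvelope, this, hf, EReal.toReal_coe, EReal.toReal_coe]

/-- The prox inequality: the Moreau envelope lies above its tangent planes. -/
theorem add_inner_le {y q : H} (hl : 0 < l) (h : IsProx Φ l x p) (h' : IsProx Φ l y q) :
    moreauEnvelope Φ l x + inner ℝ ((1 / l) • (x - p)) (y - x) ≤ moreauEnvelope Φ l y := by
  rw [h.moreauEnvelope_eq hl, h'.moreauEnvelope_eq hl]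
  obtain ⟨f, hf, hsub⟩ := h
  obtain ⟨f', hf', -⟩ := h'
  have h1 := hsub q f' hf'.le
  rw [hf, hf', EReal.toReal_coe, EReal.toReal_coe]
  obtain ⟨g, hg⟩ : ∃ g, g = (1 / l) • (x - p) := ⟨_, rfl⟩
  have hxp : x - p = l • g := by rw [hg, smul_smul]; field_simp; simp
  -- Completing the square around l g leaves only ‖(y - x) - (q - p)‖² / (2l), which is discarded.
  have h2 : y - q = (l • g) + ((y - x) - (q - p)) := by rw [← hxp]; abel
  have h3 : 1 / l * inner ℝ (x - p) (q - p) = inner ℝ g (q - p) := by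
    rw [hg, real_inner_smul_left]
  rw [h3] at h1
  rw [← hg, h2, hxp, norm_add_sq_real, norm_smul, real_inner_smul_left,
    inner_sub_right g (y - x) (q - p)]
  have h4 : ((‖l‖ * ‖g‖) ^ 2 + 2 * (l * (inner ℝ g (y - x) - inner ℝ g (q - p)))
      + ‖y - x - (q - p)‖ ^ 2) / (2 * l) = (‖l‖ * ‖g‖) ^ 2 / (2 * l)
      + (inner ℝ g (y - x) - inner ℝ g (q - p)) + ‖y - x - (q - p)‖ ^ 2 / (2 * l) := by
    field_simp
  rw [h4]
  have : 0 ≤ ‖y - x - (q - p)‖ ^ 2 / (2 * l) := by positivity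
  linarith

/-- Here p is a competitor, not optimal, for (l', y). Letting both point and index vary serves the
upper bound in `hasGradientAt` as well as the index comparison. -/
theorem moreauEnvelope_le {l' : ℝ} {y q : H} (hl' : 0 < l') (h : IsProx Φ l x p)
    (h' : IsProx Φ l' y q) :
    moreauEnvelope Φ l' y ≤ (Φ p).toReal + ‖y - p‖ ^ 2 / (2 * l') := by
  rw [h'.moreauEnvelope_eq hl']
  obtain ⟨f, hf, hsub⟩ := h
  obtain ⟨f', hf', hsub'⟩ := h'
  have h1 := hsub' p f hf.le
  rw [hf, hf', EReal.toReal_coe, EReal.toReal_coe]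
  have h2 : y - p = (y - q) - (p - q) := by abel
  rw [h2, norm_sub_sq_real (y - q) (p - q)]
  have : (‖y - q‖ ^ 2 - 2 * inner ℝ (y - q) (p - q) + ‖p - q‖ ^ 2) / (2 * l')
            = ‖y - q‖ ^ 2 / (2 * l') - 1 / l' * inner ℝ (y - q) (p - q)
              + ‖p - q‖ ^ 2 / (2 * l') := by field_simp
  rw [this]
  have : 0 ≤ ‖p - q‖ ^ 2 / (2 * l') := by positivity
  linarith

/-- The envelope is squeezed between its tangent plane and that plane plus ‖y - x‖² / (2l), the
upper bound coming from p as a competitor at y. -/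
theorem hasGradientAt [CompleteSpace H] (hl : 0 < l) (hex : ∀ y, ∃ q, IsProx Φ l y q)
    (h : IsProx Φ l x p) : HasGradientAt (moreauEnvelope Φ l) ((1 / l) • (x - p)) x := by
  rw [hasGradientAt_iff_isLittleO]
  have hO : (fun y => moreauEnvelope Φ l y - moreauEnvelope Φ l x
      - inner ℝ ((1 / l) • (x - p)) (y - x)) =O[𝓝 x] fun y => ‖y - x‖ ^ 2 := by
    refine Asymptotics.IsBigO.of_bound (1 / (2 * l)) (Eventually.of_forall fun y => ?_)
    obtain ⟨q, hq⟩ := hex y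
    have h1 := h.add_inner_le hl hq
    have h2 := h.moreauEnvelope_le hl hq
    have h3 := h.moreauEnvelope_eq hl
    have h4 : y - p = (x - p) + (y - x) := by abel
    have h5 : ‖y - p‖ ^ 2 / (2 * l) = ‖x - p‖ ^ 2 / (2 * l)
        + inner ℝ ((1 / l) • (x - p)) (y - x) + 1 / (2 * l) * ‖y - x‖ ^ 2 := by
      rw [h4, @norm_add_sq_real, real_inner_smul_left]
      field_simp
    rw [Real.norm_eq_abs, Real.norm_eq_abs, abs_of_nonneg (by linarith),
      abs_of_nonneg (by positivity)]
    linarith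
  refine hO.trans_isLittleO ?_
  have := Asymptotics.isLittleO_norm_pow_id (E' := H) one_lt_two
  exact this.comp_tendsto (by simpa using (tendsto_id (x := 𝓝 x)).sub_const x)

theorem monotone {l' : ℝ} {y q : H} (h : IsProx Φ l x p) (h' : IsProx Φ l' y q) :
    1 / l * inner ℝ (x - p) (q - p) + 1 / l' * inner ℝ (y - q) (p - q) ≤ 0 := by
  obtain ⟨f, hf, hsub⟩ := h
  obtain ⟨f', hf', hsub'⟩ := h'
  have h1 := hsub' p f hf.le
  have h2 := hsub q f' hf'.le
  linarith

end IsProx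

end ProximalPoints

/-! ### The proximal path τ ↦ P(τ) issued from 0. -/

section ProximalPath

variable {H : Type*} [NormedAddCommGroup H] [InnerProductSpace ℝ H] {Φ : H → EReal}

theorem IsProx.norm_le_of_mem_argmin {τ : ℝ} (hτ : 0 < τ) {P w : H} (hP : IsProx Φ τ 0 P)
    (hw : w ∈ argminSet Φ) : ‖P‖ ≤ ‖w‖ := by
  obtain ⟨f, hf, hsub⟩ := hP
  have h1 := hsub w f (hf ▸ hw P)
  have h2 : inner ℝ (0 - P) (w - P) ≤ 0 := by
    have : 1 / τ * inner ℝ (0 - P) (w - P) ≤ 1 / τ * 0 := by linarith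
    exact le_of_mul_le_mul_left this (by positivity)
  rw [zero_sub, inner_neg_left, inner_sub_right, real_inner_self_eq_norm_sq] at h2
  have h3 := real_inner_le_norm P w
  by_contra! hcon
  nlinarith [norm_nonneg w, norm_nonneg P]

/-- Monotonicity between the two indices yields a Lipschitz bound with denominator and norm taken at
the same index, so the relative change of τ controls the path. -/
theorem IsProx.norm_sub_le {τ τ' : ℝ} (hτ : 0 < τ) (hτ' : 0 < τ') {P P' : H}
    (hP : IsProx Φ τ 0 P) (hP' : IsProx Φ τ' 0 P') : ‖P - P'‖ ≤ |τ - τ'| / τ' * ‖P'‖ := by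
  have h := hP.monotone hP'
  have h1 : inner ℝ (0 - P) (P' - P) = inner ℝ P (P - P') := by
    rw [zero_sub, ← neg_sub P P', inner_neg_neg]
  have h2 : inner ℝ (0 - P') (P - P') = - inner ℝ P' (P - P') := by rw [zero_sub, inner_neg_left]
  have h3 : inner ℝ P (P - P') = ‖P - P'‖ ^ 2 + inner ℝ P' (P - P') := by
    rw [← real_inner_self_eq_norm_sq, ← inner_add_left, sub_add_cancel]
  rw [h1, h2, h3] at h
  have h4 : ‖P - P'‖ ^ 2 ≤ (τ - τ') / τ' * inner ℝ P' (P - P') := by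
    have : τ * (1 / τ * (‖P - P'‖ ^ 2 + inner ℝ P' (P - P')) + 1 / τ' * -inner ℝ P' (P - P'))
        = ‖P - P'‖ ^ 2 - (τ - τ') / τ' * inner ℝ P' (P - P') := by field_simp; ring
    nlinarith
  have h5 : (τ - τ') / τ' * inner ℝ P' (P - P') ≤ |τ - τ'| / τ' * (‖P'‖ * ‖P - P'‖) := by
    refine (le_abs_self _).trans ?_
    rw [abs_mul, abs_div, abs_of_pos hτ']
    gcongr
    exact abs_real_inner_le_norm _ _
  rcases (norm_nonneg (P - P')).eq_or_lt with h0 | h0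
  · rw [← h0]; positivity
  · exact le_of_mul_le_mul_right (by nlinarith) h0

/-- Monotonicity rearranges to (τ + τ')‖P - P'‖² ≤ (τ' - τ)(‖P'‖² - ‖P‖²). Convergence of the path
is thereby reduced to that of a monotone bounded real function. -/
theorem IsProx.norm_sub_sq_le {τ τ' : ℝ} (hτ : 0 < τ) (hττ' : τ ≤ τ') {P P' : H}
    (hP : IsProx Φ τ 0 P) (hP' : IsProx Φ τ' 0 P') :
    ‖P - P'‖ ^ 2 ≤ ‖P'‖ ^ 2 - ‖P‖ ^ 2 := by
  have hτ' := hτ.trans_le hττ'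
  have h := hP.monotone hP'
  have h1 : inner ℝ (0 - P) (P' - P) = ‖P‖ ^ 2 - inner ℝ P P' := by
    rw [zero_sub, inner_neg_left, inner_sub_right, real_inner_self_eq_norm_sq]; ring
  have h2 : inner ℝ (0 - P') (P - P') = ‖P'‖ ^ 2 - inner ℝ P P' := by
    rw [zero_sub, inner_neg_left, inner_sub_right, real_inner_self_eq_norm_sq,
      real_inner_comm]; ring
  have h3 := norm_sub_sq_real P P'
  have h4 := norm_nonneg (P - P')
  rw [h1, h2] at h
  have h5 : τ' * (‖P‖ ^ 2 - inner ℝ P P') + τ * (‖P'‖ ^ 2 - inner ℝ P P') ≤ 0 := by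
    have : (τ * τ') * (1 / τ * (‖P‖ ^ 2 - inner ℝ P P') + 1 / τ' * (‖P'‖ ^ 2 - inner ℝ P P'))
        = τ' * (‖P‖ ^ 2 - inner ℝ P P') + τ * (‖P'‖ ^ 2 - inner ℝ P P') := by field_simp
    rw [← this]
    exact mul_nonpos_of_nonneg_of_nonpos (by positivity) h
  rcases hττ'.eq_or_lt with rfl | hlt
  · have h6 : τ * ‖P - P'‖ ^ 2 ≤ τ * 0 := by rw [h3]; linarith
    have h7 : ‖P - P'‖ ^ 2 ≤ 0 := le_of_mul_le_mul_left h6 hτ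
    have h8 : P - P' = 0 := by
      rw [← norm_eq_zero]
      exact pow_eq_zero_iff two_ne_zero |>.1 (le_antisymm h7 (sq_nonneg _))
    rw [sub_eq_zero.1 h8]; simp
  · have h6 : (τ + τ') * ‖P - P'‖ ^ 2 ≤ (τ' - τ) * (‖P'‖ ^ 2 - ‖P‖ ^ 2) := by rw [h3]; linarith
    have h7 : 0 ≤ ‖P'‖ ^ 2 - ‖P‖ ^ 2 := by
      by_contra! hcon
      have : 0 ≤ (τ + τ') * ‖P - P'‖ ^ 2 := by positivity
      nlinarith
    have h8 : (τ + τ') * ‖P - P'‖ ^ 2 ≤ (τ + τ') * (‖P'‖ ^ 2 - ‖P‖ ^ 2) := by nlinarith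
    exact le_of_mul_le_mul_left h8 (by linarith)

/-- Both proximal relations express the same subgradient -P / (1/e + l) at P; only the base point
and the index change. -/
theorem isProx_tikhonov {e l : ℝ} (he : 0 < e) (hl : 0 < l) {P : H}
    (hP : IsProx Φ (1 / e + l) 0 P) : IsProx Φ l ((1 / (1 + l * e)) • P) P := by
  obtain ⟨f, hf, hsub⟩ := hP
  refine ⟨f, hf, fun q r hq => ?_⟩
  have h1 := hsub q r hq
  have h2 : (1 / (1 + l * e)) • P - P = (l / (1 / e + l)) • (0 - P) := by
    rw [← sub_eq_zero]
    have : (1 / (1 + l * e)) • P - P - (l / (1 / e + l)) • (0 - P)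
        = (1 / (1 + l * e) - 1 + l / (1 / e + l)) • P := by module
    rw [this]
    convert zero_smul ℝ P
    field_simp
    ring
  rw [h2, real_inner_smul_left]
  refine le_trans (le_of_eq ?_) h1
  field_simp

end ProximalPath

/-! ### Envelope inequalities, the regularized minimizer and the limit of the path. -/

section Envelope

variable {H : Type*} [NormedAddCommGroup H] [InnerProductSpace ℝ H] [CompleteSpace H]
  {Φ : H → EReal}

theorem IsProx.gradient_eq (hex : ∀ l : ℝ, 0 < l → ∀ y, ∃ q, IsProx Φ l y q) {l : ℝ} (hl : 0 < l)
    {x p : H} (h : IsProx Φ l x p) : gradient (moreauEnvelope Φ l) x = (1 / l) • (x - p) :=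
  (h.hasGradientAt hl (hex l hl)).gradient

theorem moreauEnvelope_add_inner_le (hex : ∀ l : ℝ, 0 < l → ∀ y, ∃ q, IsProx Φ l y q) {l : ℝ}
    (hl : 0 < l) (x y : H) :
    moreauEnvelope Φ l x + inner ℝ (gradient (moreauEnvelope Φ l) x) (y - x)
      ≤ moreauEnvelope Φ l y := by
  obtain ⟨p, hp⟩ := hex l hl x
  obtain ⟨q, hq⟩ := hex l hl y
  rw [hp.gradient_eq hex hl]
  exact hp.add_inner_le hl hq

/-- Discrete form of ∂Φ_l/∂l = -½‖∇Φ_l‖², obtained by keeping the old proximal point as competitor.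
-/
theorem moreauEnvelope_index_le (hex : ∀ l : ℝ, 0 < l → ∀ y, ∃ q, IsProx Φ l y q) {l l' : ℝ}
    (hl : 0 < l) (hl' : 0 < l') (x : H) :
    moreauEnvelope Φ l' x ≤ moreauEnvelope Φ l x
      - 1 / 2 * ‖gradient (moreauEnvelope Φ l) x‖ ^ 2 * ((l' - l) * (l / l')) := by
  obtain ⟨p, hp⟩ := hex l hl x
  obtain ⟨q, hq⟩ := hex l' hl' x
  have h1 := hp.moreauEnvelope_le hl' hq
  rw [hp.gradient_eq hex hl, hp.moreauEnvelope_eq hl]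
  refine h1.trans (le_of_eq ?_)
  rw [norm_smul, Real.norm_eq_abs, abs_of_pos (by positivity)]
  field_simp
  ring

/-- The Moreau envelope under a joint change of point and index. -/
theorem moreauEnvelope_sub_le (hex : ∀ l : ℝ, 0 < l → ∀ y, ∃ q, IsProx Φ l y q) {l l' : ℝ}
    (hl : 0 < l) (hl' : 0 < l') (x x' : H) :
    moreauEnvelope Φ l' x' - moreauEnvelope Φ l x
      ≤ inner ℝ (gradient (moreauEnvelope Φ l') x') (x' - x)
        - 1 / 2 * ‖gradient (moreauEnvelope Φ l) x‖ ^ 2 * ((l' - l) * (l / l')) := by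
  have h1 := moreauEnvelope_add_inner_le hex hl' x' x
  have h2 := moreauEnvelope_index_le hex hl hl' x
  have h3 : inner ℝ (gradient (moreauEnvelope Φ l') x') (x - x')
      = - inner ℝ (gradient (moreauEnvelope Φ l') x') (x' - x) := by
    rw [← inner_neg_right, neg_sub]
  linarith

theorem gradient_tikhonov (hex : ∀ l : ℝ, 0 < l → ∀ y, ∃ q, IsProx Φ l y q) {e l : ℝ} (he : 0 < e)
    (hl : 0 < l) {P : H} (hP : IsProx Φ (1 / e + l) 0 P) :
    gradient (moreauEnvelope Φ l) ((1 / (1 + l * e)) • P) = -(e • (1 / (1 + l * e)) • P) := by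
  rw [(isProx_tikhonov he hl hP).gradient_eq hex hl, ← sub_eq_zero]
  have : (1 / l) • ((1 / (1 + l * e)) • P - P) - -(e • (1 / (1 + l * e)) • P)
      = (1 / l * (1 / (1 + l * e)) - 1 / l + e * (1 / (1 + l * e))) • P := by module
  rw [this]
  convert zero_smul ℝ P
  field_simp
  ring

theorem tikhonovFun_add_le (hex : ∀ l : ℝ, 0 < l → ∀ y, ∃ q, IsProx Φ l y q) (e : ℝ) {l : ℝ}
    (hl : 0 < l) (x y : H) :
    tikhonovFun Φ e l x + inner ℝ (gradient (moreauEnvelope Φ l) x + e • x) (y - x)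
      + e / 2 * ‖y - x‖ ^ 2 ≤ tikhonovFun Φ e l y := by
  have h1 := moreauEnvelope_add_inner_le hex hl x y
  have h2 : ‖y‖ ^ 2 = ‖x‖ ^ 2 + 2 * inner ℝ x (y - x) + ‖y - x‖ ^ 2 := by
    rw [← norm_add_sq_real]; congr 2; abel
  rw [inner_add_left, real_inner_smul_left, tikhonovFun, tikhonovFun, h2]
  linarith

/-- The candidate is critical, so strong convexity makes it the unique minimizer, and the choice
operator has no freedom. -/
theorem tikhonovPoint_eq (hex : ∀ l : ℝ, 0 < l → ∀ y, ∃ q, IsProx Φ l y q) {e l : ℝ} (he : 0 < e)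
    (hl : 0 < l) {P : H} (hP : IsProx Φ (1 / e + l) 0 P) :
    tikhonovPoint Φ e l = (1 / (1 + l * e)) • P := by
  set z := (1 / (1 + l * e)) • P with hz
  have hg := gradient_tikhonov hex he hl hP
  have hmin : ∀ y, tikhonovFun Φ e l z + e / 2 * ‖y - z‖ ^ 2 ≤ tikhonovFun Φ e l y := by
    intro y
    have := tikhonovFun_add_le hex e hl z y
    rwa [hg, neg_add_cancel, inner_zero_left, add_zero] at this
  have hspec : ∀ y, tikhonovFun Φ e l (tikhonovPoint Φ e l) ≤ tikhonovFun Φ e l y :=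
    Classical.epsilon_spec (p := fun z => ∀ y, tikhonovFun Φ e l z ≤ tikhonovFun Φ e l y)
      ⟨z, fun y => (le_add_of_nonneg_right (by positivity)).trans (hmin y)⟩
  have h1 := hspec z
  have h2 := hmin (tikhonovPoint Φ e l)
  have h3 : ‖tikhonovPoint Φ e l - z‖ ^ 2 ≤ 0 := by
    have : e / 2 * ‖tikhonovPoint Φ e l - z‖ ^ 2 ≤ e / 2 * 0 := by linarith
    exact le_of_mul_le_mul_left this (by positivity)
  have h4 : ‖tikhonovPoint Φ e l - z‖ = 0 := by
    exact pow_eq_zero_iff two_ne_zero |>.1 (le_antisymm h3 (sq_nonneg _))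
  exact sub_eq_zero.1 (norm_eq_zero.1 h4)

theorem gradient_tikhonovPoint (hex : ∀ l : ℝ, 0 < l → ∀ y, ∃ q, IsProx Φ l y q) {e l : ℝ}
    (he : 0 < e) (hl : 0 < l) :
    gradient (moreauEnvelope Φ l) (tikhonovPoint Φ e l) = -(e • tikhonovPoint Φ e l) := by
  obtain ⟨P, hP⟩ := hex (1 / e + l) (by positivity) 0
  rw [tikhonovPoint_eq hex he hl hP, gradient_tikhonov hex he hl hP]

/-- The regularized function grows quadratically away from its minimizer. -/
theorem tikhonovFun_growth (hex : ∀ l : ℝ, 0 < l → ∀ y, ∃ q, IsProx Φ l y q) {e l : ℝ}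
    (he : 0 < e) (hl : 0 < l) (y : H) :
    tikhonovFun Φ e l (tikhonovPoint Φ e l) + e / 2 * ‖y - tikhonovPoint Φ e l‖ ^ 2
      ≤ tikhonovFun Φ e l y := by
  have := tikhonovFun_add_le hex e hl (tikhonovPoint Φ e l) y
  rwa [gradient_tikhonovPoint hex he hl, neg_add_cancel, inner_zero_left, add_zero] at this

theorem exists_isMinNormMinimizer_tendsto (hproper : IsProperFun Φ) (hlsc : LowerSemicontinuous Φ)
    (hargmin : (argminSet Φ).Nonempty) {P : ℝ → H} (hP : ∀ τ, 0 < τ → IsProx Φ τ 0 (P τ)) :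
    ∃ xs, IsMinNormMinimizer Φ xs ∧ Tendsto P atTop (𝓝 xs) := by
  obtain ⟨w, hw⟩ := hargmin
  -- Cutting the index off at 1 keeps it positive, so monotonicity of the norms holds on all of ℝ
  -- without changing the limit.
  let Q : ℝ → H := fun τ => P (max τ 1)
  have hpos : ∀ τ : ℝ, 0 < max τ 1 := fun τ => lt_max_of_lt_right one_pos
  have hQ : ∀ {τ τ' : ℝ}, τ ≤ τ' → ‖Q τ - Q τ'‖ ^ 2 ≤ ‖Q τ'‖ ^ 2 - ‖Q τ‖ ^ 2 := fun h =>
    (hP _ (hpos _)).norm_sub_sq_le (hpos _) (max_le_max_right 1 h) (hP _ (hpos _))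
  have hQ' : ∀ τ τ' : ℝ, ‖Q τ - Q τ'‖ ^ 2 ≤ |‖Q τ'‖ ^ 2 - ‖Q τ‖ ^ 2| := by
    intro τ τ'
    rcases le_total τ τ' with h | h
    · exact (hQ h).trans (le_abs_self _)
    · rw [norm_sub_rev, abs_sub_comm]
      exact (hQ h).trans (le_abs_self _)
  have hmono : Monotone fun τ => ‖Q τ‖ ^ 2 := fun τ τ' h => by
    have := (sq_nonneg _).trans (hQ h)
    simp only
    linarith
  have hbdd : BddAbove (range fun τ => ‖Q τ‖ ^ 2) := by
    refine ⟨‖w‖ ^ 2, ?_⟩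
    rintro _ ⟨τ, rfl⟩
    have := (hP _ (hpos τ)).norm_le_of_mem_argmin (hpos τ) hw
    simp only
    gcongr
  have hcN : Cauchy (map (fun τ => ‖Q τ‖ ^ 2) atTop) :=
    (tendsto_atTop_ciSup hmono hbdd).cauchy_map
  have hcQ : Cauchy (map Q atTop) := by
    rw [Metric.cauchy_iff] at hcN ⊢
    refine ⟨inferInstance, fun ε hε => ?_⟩
    obtain ⟨t, ht, htε⟩ := hcN.2 (ε ^ 2) (by positivity)
    refine ⟨Q '' ((fun τ => ‖Q τ‖ ^ 2) ⁻¹' t), image_mem_map ht, ?_⟩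
    rintro _ ⟨τ, hτ, rfl⟩ _ ⟨τ', hτ', rfl⟩
    have h1 := htε _ hτ' _ hτ
    rw [Real.dist_eq] at h1
    rw [dist_eq_norm]
    exact lt_of_pow_lt_pow_left₀ 2 hε.le ((hQ' τ τ').trans_lt h1)
  obtain ⟨xs, hxs⟩ := CompleteSpace.complete hcQ
  have hQt : Tendsto Q atTop (𝓝 xs) := hxs
  have hPt : Tendsto P atTop (𝓝 xs) := by
    refine hQt.congr' ?_
    filter_upwards [eventually_ge_atTop 1] with τ hτ
    simp [Q, max_eq_left hτ]
  refine ⟨xs, ⟨fun y => ?_, fun v hv => ?_⟩, hPt⟩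
  · refine le_trans ?_ (hw y)
    by_contra! hcon
    obtain ⟨c, hc1, hc2⟩ := EReal.lt_iff_exists_real_btwn.1 hcon
    have hwtop : Φ w ≠ ⊤ := fun h => by simp [h] at hc1
    obtain ⟨m, hm⟩ : ∃ m : ℝ, Φ w = m := ⟨_, (EReal.coe_toReal hwtop (hproper.1 w)).symm⟩
    have hmc : m < c := by rw [hm] at hc1; exact_mod_cast hc1
    have hev : ∀ᶠ τ in atTop, (c : EReal) < Φ (P τ) := hPt.eventually (hlsc xs c hc2)
    -- The subgradient inequality at w, with ‖P τ‖ ≤ ‖w‖, gives Φ (P τ) ≤ m + 2‖w‖² / τ.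
    have hle : c ≤ m := by
      have ht : Tendsto (fun τ : ℝ => m + 1 / τ * (2 * ‖w‖ ^ 2)) atTop
          (𝓝 (m + 0 * (2 * ‖w‖ ^ 2))) := by
        refine Tendsto.const_add _ (Tendsto.mul_const _ ?_)
        exact tendsto_inv_atTop_zero.congr fun τ => (one_div τ).symm
      rw [zero_mul, add_zero] at ht
      refine ge_of_tendsto ht ?_
      filter_upwards [hev, eventually_gt_atTop 0] with τ hτ hτ0
      have hn := (hP τ hτ0).norm_le_of_mem_argmin hτ0 hw
      obtain ⟨f, hf, hsub⟩ := hP τ hτ0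
      have h1 := hsub w m hm.le
      have hcf : c < f := by rw [hf] at hτ; exact_mod_cast hτ
      have h2 : -(2 * ‖w‖ ^ 2) ≤ inner ℝ (0 - P τ) (w - P τ) := by
        have h3 := abs_real_inner_le_norm (0 - P τ) (w - P τ)
        have h4 : ‖w - P τ‖ ≤ 2 * ‖w‖ := (norm_sub_le _ _).trans (by linarith)
        have h5 : ‖0 - P τ‖ * ‖w - P τ‖ ≤ ‖w‖ * (2 * ‖w‖) := by
          rw [zero_sub, norm_neg]; gcongr
        have h6 := neg_abs_le (inner ℝ (0 - P τ) (w - P τ))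
        linarith
      have h7 : 1 / τ * -(2 * ‖w‖ ^ 2) ≤ 1 / τ * inner ℝ (0 - P τ) (w - P τ) := by gcongr
      linarith
    linarith
  · refine le_of_tendsto hPt.norm ?_
    filter_upwards [eventually_gt_atTop 0] with τ hτ
    exact (hP τ hτ).norm_le_of_mem_argmin hτ hv

end Envelope

/-! ### Absolute continuity and almost-everywhere derivatives. -/

section AbsoluteContinuity

/-- Domination of increments replaces differentiability: this is how z, the envelope and the minimal
value become absolutely continuous in time. -/
theorem AbsolutelyContinuousOnInterval.of_dist_le {X Y Z : Type*} [PseudoMetricSpace X]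
    [PseudoMetricSpace Y] [PseudoMetricSpace Z] {f : ℝ → X} {k : ℝ → Y} {l : ℝ → Z} {a b C : ℝ}
    (hk : AbsolutelyContinuousOnInterval k a b) (hl : AbsolutelyContinuousOnInterval l a b)
    (h : ∀ s ∈ uIcc a b, ∀ t ∈ uIcc a b,
      dist (f s) (f t) ≤ C * (dist (k s) (k t) + dist (l s) (l t))) :
    AbsolutelyContinuousOnInterval f a b := by
  unfold AbsolutelyContinuousOnInterval at hk hl ⊢
  refine squeeze_zero' ?_ ?_ (by simpa using (hk.add hl).const_mul C)
  · exact Eventually.of_forall fun _ => Finset.sum_nonneg fun i _ => dist_nonneg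
  rw [eventually_inf_principal]
  refine Eventually.of_forall ?_
  rintro ⟨n, I⟩ hnI
  simp only [AbsolutelyContinuousOnInterval.disjWithin, mem_ofPred_eq] at hnI
  simp only [← Finset.sum_add_distrib, Finset.mul_sum]
  exact Finset.sum_le_sum fun i hi => h _ (hnI.1 i hi).1 _ (hnI.1 i hi).2

theorem AbsolutelyContinuousOnInterval.norm_sq {E : Type*} [NormedAddCommGroup E] {f : ℝ → E}
    {a b : ℝ} (hf : AbsolutelyContinuousOnInterval f a b) :
    AbsolutelyContinuousOnInterval (fun t => ‖f t‖ ^ 2) a b := by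
  have h1 : AbsolutelyContinuousOnInterval (fun t => ‖f t‖) a b :=
    .of_dist_le (C := 1) hf hf fun s _ t _ => by
      have := dist_norm_norm_le (f s) (f t)
      rw [← dist_eq_norm] at this
      linarith [dist_nonneg (x := f s) (y := f t)]
  simpa only [sq] using h1.fun_mul h1

theorem AbsolutelyContinuousOnInterval.le_of_ae_deriv_nonpos {f : ℝ → ℝ} {a b : ℝ} (hab : a ≤ b)
    (hf : AbsolutelyContinuousOnInterval f a b)
    (h : ∀ᵐ t, t ∈ Ioo a b → ∀ d, HasDerivAt f d t → d ≤ 0) : f b ≤ f a := by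
  have h1 := hf.integral_deriv_eq_sub
  have h2 : 0 ≤ ∫ t in a..b, -deriv f t := by
    refine intervalIntegral.integral_nonneg_of_ae_restrict hab ?_
    rw [EventuallyLE, ae_restrict_iff' measurableSet_Icc]
    have ha : ∀ᵐ t : ℝ, t ≠ a := by simp [ae_iff]
    have hb : ∀ᵐ t : ℝ, t ≠ b := by simp [ae_iff]
    filter_upwards [h, hf.ae_differentiableAt, ha, hb] with t ht htd hta htb htm
    have htm' : t ∈ uIcc a b := by rwa [uIcc_of_le hab]
    have := ht ⟨lt_of_le_of_ne htm.1 (Ne.symm hta), lt_of_le_of_ne htm.2 htb⟩ _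
      (htd htm').hasDerivAt
    simpa using this
  rw [intervalIntegral.integral_neg] at h2
  linarith

variable {F : Type*} [NormedAddCommGroup F] [NormedSpace ℝ F] {t₀ : ℝ} {f : ℝ → F}

theorem LocallyAC.absolutelyContinuousOnInterval (hf : LocallyAC t₀ f) {a b : ℝ} (ha : t₀ ≤ a)
    (hab : a ≤ b) : AbsolutelyContinuousOnInterval f a b := by
  obtain ⟨y, hy, hfy⟩ := hf
  have hint : ∀ {s t : ℝ}, t₀ ≤ s → t₀ ≤ t → IntervalIntegrable y volume s t :=
    fun hs ht => (hy _ hs).symm.trans (hy _ ht)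
  have hn : IntervalIntegrable (fun s => ‖y s‖) volume a b := (hint ha (ha.trans hab)).norm
  have hk := hn.absolutelyContinuousOnInterval_intervalIntegral (c := a) (by simp)
  refine .of_dist_le (C := 1) hk hk fun s hs t ht => ?_
  rw [uIcc_of_le hab] at hs ht
  have hs0 := ha.trans hs.1
  have ht0 := ha.trans ht.1
  have h1 : f s - f t = ∫ r in t..s, y r := by
    rw [hfy s hs0, hfy t ht0, add_sub_add_left_eq_sub]
    exact intervalIntegral.integral_interval_sub_left (hy _ hs0) (hy _ ht0)
  have h2 : (∫ r in a..s, ‖y r‖) - ∫ r in a..t, ‖y r‖ = ∫ r in t..s, ‖y r‖ :=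
    intervalIntegral.integral_interval_sub_left (hint ha hs0).norm (hint ha ht0).norm
  have h3 : dist (f s) (f t) ≤ dist (∫ r in a..s, ‖y r‖) (∫ r in a..t, ‖y r‖) := by
    rw [dist_eq_norm, dist_eq_norm, h1, h2]
    exact intervalIntegral.norm_integral_le_abs_integral_norm
  linarith [dist_nonneg (x := ∫ r in a..s, ‖y r‖) (y := ∫ r in a..t, ‖y r‖)]

theorem LocallyAC.continuousAt (hf : LocallyAC t₀ f) {t : ℝ} (ht : t₀ < t) : ContinuousAt f t := by
  have h := (hf.absolutelyContinuousOnInterval le_rfl (by linarith : t₀ ≤ t + 1)).continuousOn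
  rw [uIcc_of_le (by linarith)] at h
  exact h.continuousAt (Icc_mem_nhds ht (by linarith))

theorem LocallyAC.continuousOn (hf : LocallyAC t₀ f) : ContinuousOn f (Ici t₀) := by
  intro t ht
  have h := (hf.absolutelyContinuousOnInterval le_rfl
    (by linarith [mem_Ici.1 ht] : t₀ ≤ t + 1)).continuousOn
  rw [uIcc_of_le (by linarith [mem_Ici.1 ht])] at h
  refine (h t ⟨ht, by linarith⟩).mono_of_mem_nhdsWithin ?_
  rw [← Ici_inter_Iic]
  exact inter_mem_nhdsWithin _ (Iic_mem_nhds (by linarith))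

/-- Lebesgue differentiation of the indefinite integral, on the countable exhaustion by [t₀, t₀ +
n]. -/
theorem LocallyAC.ae_hasDerivAt [CompleteSpace F] (hf : LocallyAC t₀ f) :
    ∀ᵐ t, t₀ < t → HasDerivAt f (timeDeriv t₀ f t) t := by
  obtain ⟨y, hy, hfy⟩ := hf
  have hae : ∀ᵐ t, ∀ n : ℕ, t ∈ uIcc t₀ (t₀ + n) →
      ∀ c ∈ uIcc t₀ (t₀ + n), HasDerivAt (fun x => ∫ s in c..x, y s) (y t) t :=
    ae_all_iff.2 fun n => (hy (t₀ + n) (by simp)).ae_hasDerivAt_integral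
  filter_upwards [hae] with t ht htt
  obtain ⟨n, hn⟩ := exists_nat_ge (t - t₀)
  have h1 := ht n (by rw [uIcc_of_le (by simp)]; exact ⟨htt.le, by linarith⟩) t₀ (by simp)
  have h2 : HasDerivAt f (y t) t := by
    refine (h1.const_add (f t₀)).congr_of_eventuallyEq ?_
    filter_upwards [Ioi_mem_nhds htt] with s hs using hfy s (le_of_lt hs)
  have h3 : timeDeriv t₀ f t = y t := by
    rw [timeDeriv, derivWithin_of_mem_nhds (Ici_mem_nhds htt), h2.deriv]
  rwa [h3]

end AbsoluteContinuity

/-! ### Dependence of the regularized minimizer and its value on the parameters. -/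

section MinimizerPath

variable {H : Type*} [NormedAddCommGroup H] [InnerProductSpace ℝ H] [CompleteSpace H]
  {Φ : H → EReal}

theorem norm_tikhonovPoint_le (hex : ∀ l : ℝ, 0 < l → ∀ y, ∃ q, IsProx Φ l y q) {w : H}
    (hw : w ∈ argminSet Φ) {e l : ℝ} (he : 0 < e) (hl : 0 < l) :
    ‖tikhonovPoint Φ e l‖ ≤ ‖w‖ := by
  have hτ : 0 < 1 / e + l := by positivity
  obtain ⟨P, hP⟩ := hex (1 / e + l) hτ 0
  rw [tikhonovPoint_eq hex he hl hP, norm_smul, Real.norm_eq_abs, abs_of_pos (by positivity)]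
  have h1 : 1 / (1 + l * e) ≤ 1 := by
    rw [div_le_one (by positivity)]
    have : 0 < l * e := by positivity
    linarith
  calc 1 / (1 + l * e) * ‖P‖ ≤ 1 * ‖P‖ := by gcongr
    _ ≤ ‖w‖ := by rw [one_mul]; exact hP.norm_le_of_mem_argmin hτ hw

theorem norm_tikhonovPoint_sub_le (hex : ∀ l : ℝ, 0 < l → ∀ y, ∃ q, IsProx Φ l y q) {w : H}
    (hw : w ∈ argminSet Φ) {e l e' l' : ℝ} (he : 0 < e) (hl : 0 < l) (he' : 0 < e')
    (hl' : 0 < l') :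
    ‖tikhonovPoint Φ e' l' - tikhonovPoint Φ e l‖
      ≤ ‖w‖ * (|(1 / e' + l') - (1 / e + l)| / (1 / e + l) + |l' * e' - l * e|) := by
  have hτ : 0 < 1 / e + l := by positivity
  have hτ' : 0 < 1 / e' + l' := by positivity
  obtain ⟨P, hP⟩ := hex (1 / e + l) hτ 0
  obtain ⟨P', hP'⟩ := hex (1 / e' + l') hτ' 0
  rw [tikhonovPoint_eq hex he hl hP, tikhonovPoint_eq hex he' hl' hP']
  have h1 := hP'.norm_sub_le hτ' hτ hP
  have h2 := hP.norm_le_of_mem_argmin hτ hw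
  -- The motion splits into that of the proximal point, governed by the index, and that of the
  -- scaling factor, governed by l e.
  have h3 : (1 / (1 + l' * e')) • P' - (1 / (1 + l * e)) • P
      = (1 / (1 + l' * e')) • (P' - P) + (1 / (1 + l' * e') - 1 / (1 + l * e)) • P := by module
  have h4 : 0 < l * e := by positivity
  have h5 : 0 < l' * e' := by positivity
  have h6 : |1 / (1 + l' * e')| ≤ 1 := by
    rw [abs_of_pos (by positivity), div_le_one (by positivity)]
    linarith
  have h7 : |1 / (1 + l' * e') - 1 / (1 + l * e)| ≤ |l' * e' - l * e| := by
    have : 1 / (1 + l' * e') - 1 / (1 + l * e)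
        = -(l' * e' - l * e) / ((1 + l' * e') * (1 + l * e)) := by
      field_simp
      ring
    rw [this, abs_div, abs_neg, abs_of_pos (a := (1 + l' * e') * (1 + l * e)) (by positivity)]
    refine div_le_self (abs_nonneg _) ?_
    nlinarith [mul_pos h4 h5]
  rw [h3]
  refine (norm_add_le _ _).trans ?_
  rw [norm_smul, norm_smul, Real.norm_eq_abs, Real.norm_eq_abs]
  calc |1 / (1 + l' * e')| * ‖P' - P‖ + |1 / (1 + l' * e') - 1 / (1 + l * e)| * ‖P‖
      ≤ 1 * (|1 / e' + l' - (1 / e + l)| / (1 / e + l) * ‖w‖) + |l' * e' - l * e| * ‖w‖ := by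
        gcongr
        exact h1.trans (by gcongr)
    _ = _ := by ring

/-- The minimal value of the regularized function under a change of the parameters. -/
theorem tikhonovFun_tikhonovPoint_sub_le (hex : ∀ l : ℝ, 0 < l → ∀ y, ∃ q, IsProx Φ l y q)
    {e l e' l' : ℝ} (he : 0 < e) (hl : 0 < l) (he' : 0 < e') (hl' : 0 < l') :
    tikhonovFun Φ e l (tikhonovPoint Φ e l) - tikhonovFun Φ e' l' (tikhonovPoint Φ e' l')
      ≤ 1 / 2 * ‖tikhonovPoint Φ e' l'‖ ^ 2
        * (e' ^ 2 * ((l' - l) * (l' / l)) + (e - e')) := by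
  -- The minimizer for (e', l') competes in the problem for (e, l). Its envelope gradient is -e' z',
  -- whence the factor e'² in the cost of changing the index.
  have h1 := tikhonovFun_growth hex he hl (tikhonovPoint Φ e' l')
  have h2 := moreauEnvelope_index_le hex hl' hl (tikhonovPoint Φ e' l')
  rw [gradient_tikhonovPoint hex he' hl', norm_neg, norm_smul, Real.norm_eq_abs,
    abs_of_pos he'] at h2
  have h3 : 0 ≤ e / 2 * ‖tikhonovPoint Φ e' l' - tikhonovPoint Φ e l‖ ^ 2 := by positivity
  have h4 : tikhonovFun Φ e l (tikhonovPoint Φ e' l')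
      = moreauEnvelope Φ l (tikhonovPoint Φ e' l') + e * ‖tikhonovPoint Φ e' l'‖ ^ 2 / 2 := rfl
  have h5 : tikhonovFun Φ e' l' (tikhonovPoint Φ e' l')
      = moreauEnvelope Φ l' (tikhonovPoint Φ e' l') + e' * ‖tikhonovPoint Φ e' l'‖ ^ 2 / 2 := rfl
  rw [h5]
  rw [h4] at h1
  have h6 : (l - l') * (l' / l) = -((l' - l) * (l' / l)) := by ring
  rw [h6] at h2
  nlinarith

end MinimizerPath

/-! ### Regularity in time along a trajectory. -/

section Flow

variable {H : Type*} [NormedAddCommGroup H] [InnerProductSpace ℝ H] [CompleteSpace H]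

/-- A strong solution `x` of the regularized system for an objective with proximal points and with
the minimizer `w`, together with the standing assumptions on the parameter functions. -/
structure TikhonovFlow (Φ : H → EReal) (α β t₀ : ℝ) (lam eps : ℝ → ℝ) (x : ℝ → H) (w : H) :
    Prop where
  exists_prox : ∀ l : ℝ, 0 < l → ∀ y, ∃ q, IsProx Φ l y q
  mem_argmin : w ∈ argminSet Φ
  lam_pos : ∀ t, t₀ ≤ t → 0 < lam t
  lam_C1 : ContDiffOn ℝ 1 lam (Ici t₀)
  lam_mono : MonotoneOn lam (Ici t₀)
  eps_pos : ∀ t, t₀ ≤ t → 0 < eps t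
  eps_C1 : ContDiffOn ℝ 1 eps (Ici t₀)
  eps_anti : AntitoneOn eps (Ici t₀)
  sol : IsStrongSolution Φ α β t₀ lam eps x

theorem hasDerivAt_timeDeriv {F : Type*} [NormedAddCommGroup F] [NormedSpace ℝ F] {f : ℝ → F}
    {t₀ t : ℝ} (hf : DifferentiableOn ℝ f (Ici t₀)) (ht : t₀ < t) :
    HasDerivAt f (timeDeriv t₀ f t) t :=
  (hf t ht.le).hasDerivWithinAt.hasDerivAt (Ici_mem_nhds ht)

theorem hasDerivAt_timeDeriv_of_contDiffOn {f : ℝ → ℝ} {t₀ t : ℝ}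
    (hf : ContDiffOn ℝ 1 f (Ici t₀)) (ht : t₀ < t) : HasDerivAt f (timeDeriv t₀ f t) t :=
  hasDerivAt_timeDeriv (hf.differentiableOn one_ne_zero) ht

theorem ContDiffOn.absolutelyContinuousOnInterval_of_Ici {F : Type*} [NormedAddCommGroup F]
    [NormedSpace ℝ F] {f : ℝ → F} {t₀ a b : ℝ} (hf : ContDiffOn ℝ 1 f (Ici t₀)) (ha : t₀ ≤ a)
    (hab : a ≤ b) : AbsolutelyContinuousOnInterval f a b := by
  refine ContDiffOn.absolutelyContinuousOnInterval (hf.mono ?_)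
  rw [uIcc_of_le hab]
  exact fun t ht => ha.trans ht.1

namespace TikhonovFlow

variable {Φ : H → EReal} {α β t₀ : ℝ} {lam eps : ℝ → ℝ} {x : ℝ → H} {w : H}

theorem x_C1 (h : TikhonovFlow Φ α β t₀ lam eps x w) : ContDiffOn ℝ 1 x (Ici t₀) := by
  have := contDiffOn_succ_iff_derivWithin (𝕜 := ℝ) (n := 0) (f := x) (uniqueDiffOn_Ici t₀)
  rw [zero_add] at this
  exact this.2 ⟨h.sol.differentiable, by simp, contDiffOn_zero.2 h.sol.velocity_ac.continuousOn⟩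

theorem sqrt_C1 (h : TikhonovFlow Φ α β t₀ lam eps x w) :
    ContDiffOn ℝ 1 (fun t => √(eps t)) (Ici t₀) :=
  h.eps_C1.sqrt fun t ht => (h.eps_pos t ht).ne'

theorem index_C1 (h : TikhonovFlow Φ α β t₀ lam eps x w) :
    ContDiffOn ℝ 1 (fun t => 1 / eps t + lam t) (Ici t₀) :=
  (contDiffOn_const.div h.eps_C1 fun t ht => (h.eps_pos t ht).ne').add h.lam_C1

theorem prod_C1 (h : TikhonovFlow Φ α β t₀ lam eps x w) :
    ContDiffOn ℝ 1 (fun t => lam t * eps t) (Ici t₀) :=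
  h.lam_C1.mul h.eps_C1

theorem index_ge (h : TikhonovFlow Φ α β t₀ lam eps x w) {s t : ℝ} (hs : t₀ ≤ s) (hst : s ≤ t) :
    1 / eps s + lam s ≤ 1 / eps t + lam t := by
  have h1 := h.eps_anti (mem_Ici.2 hs) (mem_Ici.2 (hs.trans hst)) hst
  have h2 := h.lam_mono (mem_Ici.2 hs) (mem_Ici.2 (hs.trans hst)) hst
  have h3 := one_div_le_one_div_of_le (h.eps_pos t (hs.trans hst)) h1
  linarith

/-- Since 1/ε + λ is nondecreasing, its value at a bounds all denominators from below, and
increments of z are dominated by those of 1/ε + λ and λ ε. -/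
theorem point_ac (h : TikhonovFlow Φ α β t₀ lam eps x w) {a b : ℝ} (ha : t₀ ≤ a) (hab : a ≤ b) :
    AbsolutelyContinuousOnInterval (fun t => tikhonovPoint Φ (eps t) (lam t)) a b := by
  have hτ : 0 < 1 / eps a + lam a :=
    add_pos (one_div_pos.2 (h.eps_pos a ha)) (h.lam_pos a ha)
  refine .of_dist_le (C := ‖w‖ * (1 / (1 / eps a + lam a) + 1))
    (h.index_C1.absolutelyContinuousOnInterval_of_Ici ha hab)
    (h.prod_C1.absolutelyContinuousOnInterval_of_Ici ha hab) fun s hs t ht => ?_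
  rw [uIcc_of_le hab] at hs ht
  have hs0 := ha.trans hs.1
  have ht0 := ha.trans ht.1
  have h1 := norm_tikhonovPoint_sub_le h.exists_prox h.mem_argmin (h.eps_pos t ht0)
    (h.lam_pos t ht0) (h.eps_pos s hs0) (h.lam_pos s hs0)
  have h2 := h.index_ge ha ht.1
  rw [dist_eq_norm, Real.dist_eq, Real.dist_eq]
  refine h1.trans ?_
  rw [mul_assoc]
  gcongr
  set A := |1 / eps s + lam s - (1 / eps t + lam t)|
  set B := |lam s * eps s - lam t * eps t|
  have h3 : A / (1 / eps t + lam t) ≤ A / (1 / eps a + lam a) := by gcongr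
  have h4 : 0 ≤ 1 / (1 / eps a + lam a) * B := by positivity
  have h5 : 0 ≤ A := abs_nonneg _
  have h6 : A / (1 / eps a + lam a) = 1 / (1 / eps a + lam a) * A := by ring
  linarith

/-- The gradient along the trajectory is bounded on [a, b], so the joint increment inequality, used
with the two times in either order, dominates the increments by those of x and λ. -/
theorem envelope_ac (h : TikhonovFlow Φ α β t₀ lam eps x w) {a b : ℝ} (ha : t₀ ≤ a)
    (hab : a ≤ b) :
    AbsolutelyContinuousOnInterval (fun t => moreauEnvelope Φ (lam t) (x t)) a b := by
  obtain ⟨B, hB⟩ := (h.sol.gradient_ac.absolutelyContinuousOnInterval ha hab).exists_bound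
  have hB0 : 0 ≤ B := (norm_nonneg _).trans (hB a (by simp))
  have hla := h.lam_pos a ha
  have hlb := h.lam_pos b (ha.trans hab)
  refine .of_dist_le (C := B + 1 / 2 * B ^ 2 * (lam b / lam a))
    (h.x_C1.absolutelyContinuousOnInterval_of_Ici ha hab)
    (h.lam_C1.absolutelyContinuousOnInterval_of_Ici ha hab) ?_
  have key : ∀ s ∈ uIcc a b, ∀ t ∈ uIcc a b,
      moreauEnvelope Φ (lam s) (x s) - moreauEnvelope Φ (lam t) (x t)
        ≤ (B + 1 / 2 * B ^ 2 * (lam b / lam a)) * (dist (x s) (x t) + dist (lam s) (lam t)) := by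
    intro s hs t ht
    have h1 := hB s hs
    have h2 := hB t ht
    rw [uIcc_of_le hab] at hs ht
    have hs0 := ha.trans hs.1
    have ht0 := ha.trans ht.1
    have hlt := h.lam_pos t ht0
    have hls := h.lam_pos s hs0
    refine (moreauEnvelope_sub_le h.exists_prox hlt hls (x t) (x s)).trans ?_
    have h3 : lam t ≤ lam b := h.lam_mono ht0 (ha.trans hab) ht.2
    have h4 : lam a ≤ lam s := h.lam_mono ha hs0 hs.1
    have h5 : inner ℝ (gradient (moreauEnvelope Φ (lam s)) (x s)) (x s - x t)
        ≤ B * dist (x s) (x t) := by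
      rw [dist_eq_norm]
      exact (real_inner_le_norm _ _).trans (by gcongr)
    have h6 : -(1 / 2 * ‖gradient (moreauEnvelope Φ (lam t)) (x t)‖ ^ 2
        * ((lam s - lam t) * (lam t / lam s)))
        ≤ 1 / 2 * B ^ 2 * (dist (lam s) (lam t) * (lam b / lam a)) := by
      refine (neg_le_abs _).trans ?_
      rw [abs_mul, abs_mul (lam s - lam t), abs_of_nonneg (a := 1 / 2 * _) (by positivity),
        abs_of_pos (a := lam t / lam s) (by positivity), Real.dist_eq]
      gcongr
    have h7 : 0 ≤ 1 / 2 * B ^ 2 * (lam b / lam a) * dist (x s) (x t) := by positivity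
    have h8 : 0 ≤ B * dist (lam s) (lam t) := by positivity
    linarith
  intro s hs t ht
  rw [Real.dist_eq, abs_le']
  refine ⟨key s hs t ht, ?_⟩
  have := key t ht s hs
  rw [dist_comm (x t), dist_comm (lam t)] at this
  linarith

theorem value_ac (h : TikhonovFlow Φ α β t₀ lam eps x w) {a b : ℝ} (ha : t₀ ≤ a) (hab : a ≤ b) :
    AbsolutelyContinuousOnInterval
      (fun t => tikhonovFun Φ (eps t) (lam t) (tikhonovPoint Φ (eps t) (lam t))) a b := by
  have hla := h.lam_pos a ha
  have hlb := h.lam_pos b (ha.trans hab)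
  have hea := h.eps_pos a ha
  refine .of_dist_le (C := 1 / 2 * ‖w‖ ^ 2 * (eps a ^ 2 * (lam b / lam a) + 1))
    (h.eps_C1.absolutelyContinuousOnInterval_of_Ici ha hab)
    (h.lam_C1.absolutelyContinuousOnInterval_of_Ici ha hab) ?_
  have key : ∀ s ∈ uIcc a b, ∀ t ∈ uIcc a b,
      tikhonovFun Φ (eps s) (lam s) (tikhonovPoint Φ (eps s) (lam s))
        - tikhonovFun Φ (eps t) (lam t) (tikhonovPoint Φ (eps t) (lam t))
        ≤ 1 / 2 * ‖w‖ ^ 2 * (eps a ^ 2 * (lam b / lam a) + 1)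
          * (dist (eps s) (eps t) + dist (lam s) (lam t)) := by
    intro s hs t ht
    rw [uIcc_of_le hab] at hs ht
    have hs0 := ha.trans hs.1
    have ht0 := ha.trans ht.1
    have hlt := h.lam_pos t ht0
    have hls := h.lam_pos s hs0
    have het := h.eps_pos t ht0
    have hes := h.eps_pos s hs0
    refine (tikhonovFun_tikhonovPoint_sub_le h.exists_prox hes hls het hlt).trans ?_
    have h2 := norm_tikhonovPoint_le h.exists_prox h.mem_argmin het hlt
    have h3 : lam t ≤ lam b := h.lam_mono ht0 (ha.trans hab) ht.2
    have h4 : lam a ≤ lam s := h.lam_mono ha hs0 hs.1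
    have h5 : eps t ≤ eps a := h.eps_anti ha ht0 ht.1
    have h6 : eps t ^ 2 * ((lam t - lam s) * (lam t / lam s)) + (eps s - eps t)
        ≤ eps a ^ 2 * (dist (lam s) (lam t) * (lam b / lam a)) + dist (eps s) (eps t) := by
      rw [dist_comm (lam s), Real.dist_eq, Real.dist_eq]
      have h9 : (lam t - lam s) * (lam t / lam s) ≤ |lam t - lam s| * (lam b / lam a) := by
        gcongr
        exact le_abs_self _
      exact add_le_add ((mul_le_mul_of_nonneg_left h9 (by positivity)).trans (by gcongr))
        (le_abs_self _)
    have h7 : 0 ≤ eps a ^ 2 * (lam b / lam a) * dist (eps s) (eps t) := by positivity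
    have h8 := dist_nonneg (x := lam s) (y := lam t)
    calc _ ≤ 1 / 2 * ‖tikhonovPoint Φ (eps t) (lam t)‖ ^ 2
          * (eps a ^ 2 * (dist (lam s) (lam t) * (lam b / lam a)) + dist (eps s) (eps t)) := by
          gcongr
      _ ≤ 1 / 2 * ‖w‖ ^ 2
          * (eps a ^ 2 * (dist (lam s) (lam t) * (lam b / lam a)) + dist (eps s) (eps t)) := by
          gcongr
      _ ≤ 1 / 2 * ‖w‖ ^ 2 * ((eps a ^ 2 * (lam b / lam a) + 1)
          * (dist (eps s) (eps t) + dist (lam s) (lam t))) := by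
          gcongr
          linarith
      _ = _ := by ring
  intro s hs t ht
  rw [Real.dist_eq, abs_le']
  refine ⟨key s hs t ht, ?_⟩
  have := key t ht s hs
  rw [dist_comm (eps t), dist_comm (lam t)] at this
  linarith

theorem energy_ac (h : TikhonovFlow Φ α β t₀ lam eps x w) (γ : ℝ) {a b : ℝ} (ha : t₀ ≤ a)
    (hab : a ≤ b) : AbsolutelyContinuousOnInterval (energy Φ β γ t₀ lam eps x) a b := by
  have hx := h.x_C1.absolutelyContinuousOnInterval_of_Ici ha hab
  have he := h.eps_C1.absolutelyContinuousOnInterval_of_Ici ha hab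
  have hs := h.sqrt_C1.absolutelyContinuousOnInterval_of_Ici ha hab
  have hz := h.point_ac ha hab
  have hv := (((hs.const_mul γ).fun_smul (hx.fun_sub hz)).fun_add
    (h.sol.velocity_ac.absolutelyContinuousOnInterval ha hab)).fun_add
    ((h.sol.gradient_ac.absolutelyContinuousOnInterval ha hab).const_smul β)
  have hφ := ((h.envelope_ac ha hab).fun_add
    ((he.fun_mul hx.norm_sq).const_mul (1 / 2))).fun_sub (h.value_ac ha hab)
  have heq : energy Φ β γ t₀ lam eps x = fun t =>
      moreauEnvelope Φ (lam t) (x t) + 1 / 2 * (eps t * ‖x t‖ ^ 2)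
        - tikhonovFun Φ (eps t) (lam t) (tikhonovPoint Φ (eps t) (lam t))
        + 1 / 2 * ‖(γ * √(eps t)) • (x t - tikhonovPoint Φ (eps t) (lam t)) + timeDeriv t₀ x t
          + β • gradient (moreauEnvelope Φ (lam t)) (x t)‖ ^ 2 := by
    funext t
    simp only [energy, tikhonovFun]
    ring
  rw [heq]
  exact hφ.fun_add (hv.norm_sq.const_mul (1 / 2))

end TikhonovFlow

end Flow

/-! ### The scalar quadratic estimate. -/

section Algebra

theorem mul_le_young {k : ℝ} (hk : 0 < k) (p q : ℝ) : p * q ≤ p ^ 2 / (2 * k) + k / 2 * q ^ 2 := by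
  have : p ^ 2 / (2 * k) + k / 2 * q ^ 2 - p * q = (p - k * q) ^ 2 / (2 * k) := by
    field_simp
    ring
  have : 0 ≤ (p - k * q) ^ 2 / (2 * k) := by positivity
  linarith

-- With W = x - z: A, Y, B, N, Z, V stand for the norms of W, x', g = ∇Φ_λ(x), x, z and v; wy, wg,
-- yg, gX, wφ for inner products; D for the value gap; L for the speed bound of z. The wy terms
-- cancel. The coefficients of D, N², A² and Y² are nonpositive by `h0a`, `h2`, `h1` and `h0b`
-- respectively. Half of -β B² pays for the cross term between g and x, the other half, by `hsmall`,
-- for every B² term carrying a factor s. Only L² survives.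
set_option maxHeartbeats 1000000 in
theorem energy_rate_scalar {α β γ c κ s r ld A Y B N Z L V D wy wg yg gX wφ : ℝ} (hβ : 0 < β)
    (hγ : 0 < γ) (hγα : γ < α) (hc : 0 < c) (hκ : 0 < κ) (hs : 0 < s) (hr : 0 ≤ r)
    (hld : 0 ≤ ld) (hB : 0 ≤ B) (hL : 0 ≤ L)
    (h0a : r ≤ 2 * γ - α + γ * β * r * s) (h0b : r ≤ α - γ - 2 * κ)
    (h1 : 2 * γ * (α - γ) + γ / c - 1 ≤ 0)
    (h2 : 2 * β * s ^ 4 + (2 - γ * β * s) * (-2 * r * s ^ 3) ≤ 0)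
    (hsmall : s * (2 * α * β ^ 2 + β ^ 2 * α ^ 2 / (2 * κ) + β ^ 2 / 2) ≤ β / 2)
    (hD : 0 ≤ D) (hwφ : D + s ^ 2 / 2 * A ^ 2 ≤ wφ)
    (hwg : D - s ^ 2 / 2 * (N ^ 2 - Z ^ 2) ≤ wg) (hwg' : wg ≤ A * B) (hyg : yg ≤ Y * B)
    (hgX : -gX ≤ B * N) (hV : V ≤ γ * s * A + Y + β * B) :
    -(1 / 2) * ld * B ^ 2 - r * s ^ 3 * N ^ 2 - γ * s * wφ - β * B ^ 2 - β * s ^ 2 * gX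
      - (α - γ) * s * (γ * s * wy + Y ^ 2 + β * yg)
      - γ * r * s ^ 2 * (γ * s * A ^ 2 + wy + β * wg) + γ * s * V * L
      + s * (r + α - γ) * (D + 1 / 2 * (γ ^ 2 * s ^ 2 * A ^ 2 + Y ^ 2 + β ^ 2 * B ^ 2
        + 2 * (γ * s * wy) + 2 * (γ * s * β * wg) + 2 * (β * yg)))
      ≤ s * (γ ^ 2 / κ + γ ^ 2 * c / 2 + γ ^ 2 / 2) * L ^ 2 := by
  have hαγ : 0 < α - γ := by linarith
  have hrα : r ≤ α := by linarith
  have e1 : γ * s * (D + s ^ 2 / 2 * A ^ 2) ≤ γ * s * wφ := by gcongr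
  have e2 : β * s ^ 2 * (-gX) ≤ β / 2 * B ^ 2 + β / 2 * (s ^ 4 * N ^ 2) := by
    have : s ^ 2 * (-gX) ≤ s ^ 2 * (B * N) := by gcongr
    have h' := mul_le_mul_of_nonneg_left this hβ.le
    linarith [mul_nonneg hβ.le (sq_nonneg (B - s ^ 2 * N))]
  have e3 : γ * r * s ^ 2 * β * (D - s ^ 2 / 2 * (N ^ 2 - Z ^ 2)) ≤ γ * r * s ^ 2 * β * wg := by
    gcongr
  have e3' : 0 ≤ γ * r * s ^ 2 * β * (s ^ 2 / 2 * Z ^ 2) := by positivity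
  have e4 : s * D * (r - (2 * γ - α + γ * β * r * s)) ≤ 0 :=
    mul_nonpos_of_nonneg_of_nonpos (by positivity) (by linarith)
  have e5 : N ^ 2 * (2 * β * s ^ 4 + (2 - γ * β * s) * (-2 * r * s ^ 3)) ≤ 0 :=
    mul_nonpos_of_nonneg_of_nonpos (by positivity) h2
  have e6 : 0 ≤ ld * B ^ 2 := by positivity
  have e7 : s * ((r + α - γ) * (γ * s * β * wg))
      ≤ s * ((r + α - γ) * (1 / 2 * (γ ^ 2 * s ^ 2 * A ^ 2 + β ^ 2 * B ^ 2))) := by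
    have : γ * s * β * wg ≤ γ * s * β * (A * B) := by gcongr
    refine mul_le_mul_of_nonneg_left (mul_le_mul_of_nonneg_left ?_ (by linarith)) hs.le
    linarith [sq_nonneg (γ * s * A - β * B)]
  have e8 : s * (β * r * yg) ≤ s * (κ / 2 * Y ^ 2 + β ^ 2 * r ^ 2 * B ^ 2 / (2 * κ)) := by
    have h' := mul_le_young hκ (β * r * B) Y
    have : β * r * yg ≤ β * r * (Y * B) := by gcongr
    refine mul_le_mul_of_nonneg_left ?_ hs.le
    have h'' : (β * r * B) ^ 2 = β ^ 2 * r ^ 2 * B ^ 2 := by ring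
    rw [h''] at h'
    linarith
  have e9 : s * (γ * V * L) ≤ s * (γ * (γ * s * A + Y + β * B) * L) := by gcongr
  have e10 : s * γ ^ 2 * ((s * A) * L) ≤ s * γ ^ 2 * ((s * A) ^ 2 / (2 * c) + c / 2 * L ^ 2) :=
    mul_le_mul_of_nonneg_left (mul_le_young hc _ _) (by positivity)
  have e11 : s * ((γ * L) * Y) ≤ s * ((γ * L) ^ 2 / (2 * κ) + κ / 2 * Y ^ 2) :=
    mul_le_mul_of_nonneg_left (mul_le_young hκ _ _) hs.le
  have e12 : s * (γ * L * (β * B)) ≤ s * (1 / 2 * γ ^ 2 * L ^ 2 + 1 / 2 * β ^ 2 * B ^ 2) := by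
    refine mul_le_mul_of_nonneg_left ?_ hs.le
    linarith [sq_nonneg (γ * L - β * B)]
  have e13 : γ / 2 * s ^ 3 * A ^ 2 * (2 * γ * (α - γ) + γ / c - 1) ≤ 0 :=
    mul_nonpos_of_nonneg_of_nonpos (by positivity) h1
  have e14 : s * Y ^ 2 * (r - (α - γ - 2 * κ)) ≤ 0 :=
    mul_nonpos_of_nonneg_of_nonpos (by positivity) (by linarith)
  have e15 : B ^ 2 * (s * (2 * α * β ^ 2 + β ^ 2 * α ^ 2 / (2 * κ) + β ^ 2 / 2))
      ≤ B ^ 2 * (β / 2) := by gcongr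
  have e16 : s * β ^ 2 * B ^ 2 * (r + α - γ) ≤ s * β ^ 2 * B ^ 2 * (2 * α) := by
    gcongr
    linarith
  have e17 : s * (β ^ 2 * r ^ 2 * B ^ 2 / (2 * κ)) ≤ s * (β ^ 2 * α ^ 2 * B ^ 2 / (2 * κ)) := by
    gcongr
  have d2 : s * γ ^ 2 * ((s * A) ^ 2 / (2 * c)) = γ / 2 * s ^ 3 * A ^ 2 * (γ / c) := by
    field_simp
  have d3 : (γ * L) ^ 2 / (2 * κ) = γ ^ 2 / (2 * κ) * L ^ 2 := by ring
  have d4 : B ^ 2 * (s * (β ^ 2 * α ^ 2 / (2 * κ))) = s * (β ^ 2 * α ^ 2 * B ^ 2 / (2 * κ)) := by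
    ring
  -- The stated constant is twice what Young's inequality produces here; the surplus is nonnegative
  -- by `d6`.
  have d5 : γ ^ 2 / κ = 2 * (γ ^ 2 / (2 * κ)) := by field_simp
  have d6 : 0 ≤ s * (γ ^ 2 / (2 * κ) * L ^ 2) := by positivity
  rw [d3] at e11
  rw [d5]
  rw [mul_add (s * γ ^ 2), d2] at e10
  set Q1 := γ ^ 2 / (2 * κ)
  set Q2 := γ / c
  set Q3 := β ^ 2 * α ^ 2 * B ^ 2 / (2 * κ)
  set Q4 := β ^ 2 * r ^ 2 * B ^ 2 / (2 * κ)
  set Q5 := β ^ 2 * α ^ 2 / (2 * κ)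
  linarith

end Algebra

/-! ### Upper bound for the derivative of the energy. -/

section EnergyDerivative

theorem HasDerivAt.tendsto_slope_gt {F : Type*} [NormedAddCommGroup F] [NormedSpace ℝ F]
    {f : ℝ → F} {t : ℝ} {d : F} (hf : HasDerivAt f d t) :
    Tendsto (slope f t) (𝓝[>] t) (𝓝 d) :=
  hf.tendsto_slope.mono_left (nhdsWithin_mono t fun _ hs => ne_of_gt hs)

theorem le_of_eventually_slope_le {f R : ℝ → ℝ} {t d r : ℝ} (hf : HasDerivAt f d t)
    (hR : Tendsto R (𝓝[>] t) (𝓝 r)) (h : ∀ᶠ s in 𝓝[>] t, slope f t s ≤ R s) : d ≤ r :=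
  le_of_tendsto_of_tendsto hf.tendsto_slope_gt hR h

variable {H : Type*} [NormedAddCommGroup H] [InnerProductSpace ℝ H]

/-- Convexity of ½‖·‖² at the later point b. The increment then enters linearly, and v need not be
differentiable. -/
theorem half_norm_sq_sub_le (a b : H) :
    1 / 2 * ‖b‖ ^ 2 - 1 / 2 * ‖a‖ ^ 2 ≤ inner ℝ b (b - a) := by
  have h1 := norm_sub_sq_real b a
  have h2 : inner ℝ b (b - a) = ‖b‖ ^ 2 - inner ℝ b a := by
    rw [inner_sub_right, real_inner_self_eq_norm_sq]
  have h3 := sq_nonneg ‖b - a‖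
  linarith

variable [CompleteSpace H]

namespace TikhonovFlow

variable {Φ : H → EReal} {α β t₀ : ℝ} {lam eps : ℝ → ℝ} {x : ℝ → H} {w : H}

theorem continuousAt_point (h : TikhonovFlow Φ α β t₀ lam eps x w) {t : ℝ} (ht : t₀ < t) :
    ContinuousAt (fun t => tikhonovPoint Φ (eps t) (lam t)) t := by
  have h := (h.point_ac le_rfl (by linarith : t₀ ≤ t + 1)).continuousOn
  rw [uIcc_of_le (by linarith)] at h
  exact h.continuousAt (Icc_mem_nhds ht (by linarith))

/-- Only E itself is assumed differentiable at t, not its summands. Forward difference quotients are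
bounded by expressions in differentiable or continuous data, whose limits form the right-hand side.
-/
theorem deriv_energy_le (h : TikhonovFlow Φ α β t₀ lam eps x w) {γ t d τd ρd : ℝ} {q : H}
    (hγ : 0 ≤ γ) (ht : t₀ < t)
    (hu : HasDerivAt (fun s => timeDeriv t₀ x s
      + β • gradient (moreauEnvelope Φ (lam s)) (x s)) q t)
    (hτ : HasDerivAt (fun s => 1 / eps s + lam s) τd t)
    (hρ : HasDerivAt (fun s => lam s * eps s) ρd t)
    (hE : HasDerivAt (energy Φ β γ t₀ lam eps x) d t)
    {g y z v : H} (hg : g = gradient (moreauEnvelope Φ (lam t)) (x t))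
    (hy : y = timeDeriv t₀ x t) (hz : z = tikhonovPoint Φ (eps t) (lam t))
    (hv : v = (γ * √(eps t)) • (x t - z) + y + β • g) :
    d ≤ inner ℝ g y - 1 / 2 * ‖g‖ ^ 2 * timeDeriv t₀ lam t
      + (1 / 2 * (timeDeriv t₀ eps t * ‖x t‖ ^ 2) + eps t * inner ℝ (x t) y)
      + 1 / 2 * ‖w‖ ^ 2 * (eps t ^ 2 * timeDeriv t₀ lam t - timeDeriv t₀ eps t)
      + (inner ℝ v (q + (γ * √(eps t)) • y
          + (γ * (timeDeriv t₀ eps t / (2 * √(eps t)))) • (x t - z))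
        + γ * √(eps t) * ‖v‖
          * (‖w‖ * (τd / (1 / eps t + lam t) + |ρd|))) := by
  set G : ℝ → H := fun s => gradient (moreauEnvelope Φ (lam s)) (x s) with hG
  set Z : ℝ → H := fun s => tikhonovPoint Φ (eps s) (lam s) with hZ
  set u : ℝ → H := fun s => timeDeriv t₀ x s + β • G s with hudef
  set V : ℝ → H := fun s => (γ * √(eps s)) • (x s - Z s) + timeDeriv t₀ x s + β • G s with hVdef
  have hlt := h.lam_pos t ht.le
  have het := h.eps_pos t ht.le
  have hxd : HasDerivAt x y t := hy ▸ hasDerivAt_timeDeriv h.sol.differentiable ht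
  have hld := hasDerivAt_timeDeriv_of_contDiffOn h.lam_C1 ht
  have hed := hasDerivAt_timeDeriv_of_contDiffOn h.eps_C1 ht
  have hsd := hed.sqrt het.ne'
  have hGc : ContinuousAt G t := h.sol.gradient_ac.continuousAt ht
  have hZc : ContinuousAt Z t := h.continuousAt_point ht
  have hyc : ContinuousAt (timeDeriv t₀ x) t := h.sol.velocity_ac.continuousAt ht
  have hVc : ContinuousAt V t :=
    (((hsd.continuousAt.const_mul γ).smul (hxd.continuousAt.sub hZc)).add hyc).add
      (hGc.const_smul β)
  have hN : HasDerivAt (fun s => 1 / 2 * (eps s * ‖x s‖ ^ 2))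
      (1 / 2 * (timeDeriv t₀ eps t * ‖x t‖ ^ 2) + eps t * inner ℝ (x t) y) t :=
    ((hed.fun_mul hxd.norm_sq).const_mul (1 / 2 : ℝ)).congr_deriv (by ring)
  have hU : HasDerivAt (fun s => u s + (γ * √(eps s)) • x s)
      (q + ((γ * √(eps t)) • y + (γ * (timeDeriv t₀ eps t / (2 * √(eps t)))) • x t)) t :=
    hu.add ((hsd.const_mul γ).smul hxd)
  let R : ℝ → ℝ := fun s =>
    inner ℝ (G s) (slope x t s) - (1 / 2 : ℝ) * ‖g‖ ^ 2 * (slope lam t s * (lam t / lam s))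
      + slope (fun s => 1 / 2 * (eps s * ‖x s‖ ^ 2)) t s
      + 1 / 2 * ‖w‖ ^ 2 * (eps s ^ 2 * (slope lam t s * (lam s / lam t)) - slope eps t s)
      + (inner ℝ (V s) (slope (fun s => u s + (γ * √(eps s)) • x s) t s
          - (γ * slope (fun s => √(eps s)) t s) • z)
        + γ * √(eps s) * ‖V s‖ * (‖w‖ * (slope (fun s => 1 / eps s + lam s) t s
          / (1 / eps t + lam t) + |slope (fun s => lam s * eps s) t s|)))
  have hle : 𝓝[>] t ≤ 𝓝 t := nhdsWithin_le_nhds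
  have hR := (((((hGc.tendsto.mono_left hle).inner hxd.tendsto_slope_gt).sub
      ((hld.tendsto_slope_gt.mul ((tendsto_const_nhds (x := lam t)).div
        (hld.continuousAt.tendsto.mono_left hle) hlt.ne')).const_mul (1 / 2 * ‖g‖ ^ 2))).add
      hN.tendsto_slope_gt).add
      ((((hed.continuousAt.tendsto.mono_left hle).pow 2).mul (hld.tendsto_slope_gt.mul
        ((hld.continuousAt.tendsto.mono_left hle).div_const (lam t)))).sub
        hed.tendsto_slope_gt |>.const_mul (1 / 2 * ‖w‖ ^ 2))).add
      (((hVc.tendsto.mono_left hle).inner (hU.tendsto_slope_gt.sub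
        ((hsd.tendsto_slope_gt.const_mul γ).smul_const z))).add
      ((((hsd.continuousAt.tendsto.mono_left hle).const_mul γ).mul
        (hVc.tendsto.mono_left hle).norm).mul
        (((hτ.tendsto_slope_gt.div_const (1 / eps t + lam t)).add
          hρ.tendsto_slope_gt.abs).const_mul ‖w‖)))
  have hlim : Tendsto R (𝓝[>] t) (𝓝 (inner ℝ g y - 1 / 2 * ‖g‖ ^ 2 * timeDeriv t₀ lam t
      + (1 / 2 * (timeDeriv t₀ eps t * ‖x t‖ ^ 2) + eps t * inner ℝ (x t) y)
      + 1 / 2 * ‖w‖ ^ 2 * (eps t ^ 2 * timeDeriv t₀ lam t - timeDeriv t₀ eps t)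
      + (inner ℝ v (q + (γ * √(eps t)) • y
          + (γ * (timeDeriv t₀ eps t / (2 * √(eps t)))) • (x t - z))
        + γ * √(eps t) * ‖v‖
          * (‖w‖ * (τd / (1 / eps t + lam t) + |ρd|))))) := by
    have hVt : V t = v := by simp only [hVdef, hv, hy, hg, hz, hG, hZ]
    have hGt : G t = g := hg.symm
    rw [hVt, hGt, div_self hlt.ne', mul_one] at hR
    have hvec : q + (γ * √(eps t)) • y + (γ * (timeDeriv t₀ eps t / (2 * √(eps t)))) • (x t - z)
        = q + ((γ * √(eps t)) • y + (γ * (timeDeriv t₀ eps t / (2 * √(eps t)))) • x t)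
          - (γ * (timeDeriv t₀ eps t / (2 * √(eps t)))) • z := by module
    rw [hvec]
    exact hR
  refine le_of_eventually_slope_le hE hlim ?_
  filter_upwards [self_mem_nhdsWithin] with s hs
  have hts : t < s := hs
  have hs0 : t₀ ≤ s := ht.le.trans hts.le
  have hls := h.lam_pos s hs0
  have hes := h.eps_pos s hs0
  have hδ : 0 < (s - t)⁻¹ := inv_pos.2 (sub_pos.2 hts)
  have hmono : lam t ≤ lam s := h.lam_mono ht.le hs0 hts.le
  have hanti : eps s ≤ eps t := h.eps_anti ht.le hs0 hts.le
  have hi := h.index_ge ht.le hts.le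
  have hτ0 : 0 < 1 / eps t + lam t := add_pos (one_div_pos.2 het) hlt
  have k1 := moreauEnvelope_sub_le h.exists_prox hlt hls (x t) (x s)
  have k2 := tikhonovFun_tikhonovPoint_sub_le h.exists_prox het hlt hes hls
  -- Replacing ‖Z s‖ by ‖w‖ needs a nonnegative bracket, which holds because s > t, λ is
  -- nondecreasing and ε nonincreasing.
  have k2' : 1 / 2 * ‖Z s‖ ^ 2 * (eps s ^ 2 * ((lam s - lam t) * (lam s / lam t))
      + (eps t - eps s)) ≤ 1 / 2 * ‖w‖ ^ 2 * (eps s ^ 2 * ((lam s - lam t) * (lam s / lam t))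
      + (eps t - eps s)) := by
    have := norm_tikhonovPoint_le h.exists_prox h.mem_argmin hes hls
    have h1 : 0 ≤ lam s - lam t := by linarith
    have h2 : 0 ≤ eps t - eps s := by linarith
    gcongr
  have k3 := half_norm_sq_sub_le (V t) (V s)
  -- The increment of z, the only part without a derivative, is isolated in the last term, to be
  -- estimated by the Lipschitz bound.
  have k4 : V s - V t = (((u s + (γ * √(eps s)) • x s) - (u t + (γ * √(eps t)) • x t))
      - (γ * (√(eps s) - √(eps t))) • z) - (γ * √(eps s)) • (Z s - Z t) := by
    have : Z t = z := hz.symm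
    simp only [hVdef, hudef, this]
    module
  have k5 : -inner ℝ (V s) ((γ * √(eps s)) • (Z s - Z t)) ≤ γ * √(eps s) * ‖V s‖
      * (‖w‖ * ((1 / eps s + lam s - (1 / eps t + lam t)) / (1 / eps t + lam t)
        + |lam s * eps s - lam t * eps t|)) := by
    have h1 := norm_tikhonovPoint_sub_le h.exists_prox h.mem_argmin het hlt hes hls
    rw [abs_of_nonneg (a := 1 / eps s + lam s - (1 / eps t + lam t)) (by linarith)] at h1
    have h2 := abs_real_inner_le_norm (V s) (Z s - Z t)
    have h3 := neg_abs_le (inner ℝ (V s) (Z s - Z t))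
    rw [real_inner_smul_right]
    have h4 : -inner ℝ (V s) (Z s - Z t) ≤ ‖V s‖ * ‖Z s - Z t‖ := by linarith
    calc _ = γ * √(eps s) * -inner ℝ (V s) (Z s - Z t) := by ring
      _ ≤ γ * √(eps s) * (‖V s‖ * ‖Z s - Z t‖) := by gcongr
      _ ≤ γ * √(eps s) * (‖V s‖ * _) :=
        mul_le_mul_of_nonneg_left (mul_le_mul_of_nonneg_left h1 (norm_nonneg _)) (by positivity)
      _ = _ := by ring
  have key : energy Φ β γ t₀ lam eps x s - energy Φ β γ t₀ lam eps x t
      ≤ inner ℝ (G s) (x s - x t) - 1 / 2 * ‖g‖ ^ 2 * ((lam s - lam t) * (lam t / lam s))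
      + (1 / 2 * (eps s * ‖x s‖ ^ 2) - 1 / 2 * (eps t * ‖x t‖ ^ 2))
      + 1 / 2 * ‖w‖ ^ 2 * (eps s ^ 2 * ((lam s - lam t) * (lam s / lam t)) - (eps s - eps t))
      + (inner ℝ (V s) (((u s + (γ * √(eps s)) • x s) - (u t + (γ * √(eps t)) • x t))
          - (γ * (√(eps s) - √(eps t))) • z)
        + γ * √(eps s) * ‖V s‖ * (‖w‖ * ((1 / eps s + lam s - (1 / eps t + lam t))
          / (1 / eps t + lam t) + |lam s * eps s - lam t * eps t|))) := by
    rw [k4, inner_sub_right] at k3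
    have e1 : energy Φ β γ t₀ lam eps x s = moreauEnvelope Φ (lam s) (x s)
        + 1 / 2 * (eps s * ‖x s‖ ^ 2)
        - tikhonovFun Φ (eps s) (lam s) (Z s) + 1 / 2 * ‖V s‖ ^ 2 := by
      simp only [energy, hVdef, hZ, hG, tikhonovFun]
      ring
    have e2 : energy Φ β γ t₀ lam eps x t = moreauEnvelope Φ (lam t) (x t)
        + 1 / 2 * (eps t * ‖x t‖ ^ 2)
        - tikhonovFun Φ (eps t) (lam t) (Z t) + 1 / 2 * ‖V t‖ ^ 2 := by
      simp only [energy, hVdef, hZ, hG, tikhonovFun]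
      ring
    rw [← hg] at k1
    rw [e1, e2]
    linarith
  rw [slope_def_field, div_eq_inv_mul]
  refine (mul_le_mul_of_nonneg_left key hδ.le).trans (le_of_eq ?_)
  have hinner (A : H) (B : ℝ) : inner ℝ (V s) ((s - t)⁻¹ • A - (γ * ((s - t)⁻¹ * B)) • z)
      = (s - t)⁻¹ * inner ℝ (V s) (A - (γ * B) • z) := by
    rw [← real_inner_smul_right]
    congr 1
    module
  simp only [R, slope_def_module, smul_eq_mul]
  rw [abs_mul, abs_of_pos hδ, hinner, real_inner_smul_right]
  ring

end TikhonovFlow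

end EnergyDerivative

/-! ### The dissipation inequality at a point of differentiability. -/

section EnergyRate

variable {H : Type*} [NormedAddCommGroup H] [InnerProductSpace ℝ H]

theorem energy_rate_vector {α β γ c κ s r ld L Z D : ℝ} {W X y g v : H} (hβ : 0 < β)
    (hγ : 0 < γ) (hγα : γ < α) (hc : 0 < c) (hκ : 0 < κ) (hs : 0 < s) (hr : 0 ≤ r)
    (hld : 0 ≤ ld) (hL : 0 ≤ L)
    (h0a : r ≤ 2 * γ - α + γ * β * r * s) (h0b : r ≤ α - γ - 2 * κ)
    (h1 : 2 * γ * (α - γ) + γ / c - 1 ≤ 0)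
    (h2 : 2 * β * s ^ 4 + (2 - γ * β * s) * (-2 * r * s ^ 3) ≤ 0)
    (hsmall : s * (2 * α * β ^ 2 + β ^ 2 * α ^ 2 / (2 * κ) + β ^ 2 / 2) ≤ β / 2)
    (hD : 0 ≤ D) (hwφ : D + s ^ 2 / 2 * ‖W‖ ^ 2 ≤ inner ℝ W (g + s ^ 2 • X))
    (hwg : D - s ^ 2 / 2 * (‖X‖ ^ 2 - Z ^ 2) ≤ inner ℝ W g)
    (hv : v = (γ * s) • W + y + β • g) :
    inner ℝ g y - 1 / 2 * ‖g‖ ^ 2 * ld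
      + (1 / 2 * (-2 * r * s ^ 3 * ‖X‖ ^ 2) + s ^ 2 * inner ℝ X y)
      + (inner ℝ v (-((α * s) • y + g + s ^ 2 • X) + (γ * s) • y + (γ * (-r * s ^ 2)) • W)
        + γ * s * ‖v‖ * L)
      + s * (r + α - γ) * (D + 1 / 2 * ‖v‖ ^ 2)
      ≤ s * (γ ^ 2 / κ + γ ^ 2 * c / 2 + γ ^ 2 / 2) * L ^ 2 := by
  have hV : ‖v‖ ≤ γ * s * ‖W‖ + ‖y‖ + β * ‖g‖ := by
    rw [hv]
    refine (norm_add₃_le).trans (le_of_eq ?_)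
    rw [norm_smul, norm_smul, Real.norm_eq_abs, Real.norm_eq_abs, abs_of_pos hβ,
      abs_of_pos (mul_pos hγ hs)]
  have hgX : -inner ℝ g X ≤ ‖g‖ * ‖X‖ := by
    have h3 := neg_abs_le (inner ℝ g X)
    have h4 := abs_real_inner_le_norm g X
    linarith
  have key := energy_rate_scalar (wy := inner ℝ W y) hβ hγ hγα hc hκ hs hr hld
    (norm_nonneg g) hL h0a h0b h1 h2 hsmall hD hwφ hwg (real_inner_le_norm W g)
    (real_inner_le_norm y g) hgX hV
  have c1 := real_inner_comm W y
  have c2 := real_inner_comm W g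
  have c3 := real_inner_comm y g
  have c4 := real_inner_comm X y
  have n1 := real_inner_self_eq_norm_sq W
  have n2 := real_inner_self_eq_norm_sq y
  have n3 := real_inner_self_eq_norm_sq g
  have hvv : ‖v‖ ^ 2 = γ ^ 2 * s ^ 2 * ‖W‖ ^ 2 + ‖y‖ ^ 2 + β ^ 2 * ‖g‖ ^ 2
      + 2 * (γ * s * inner ℝ W y) + 2 * (γ * s * β * inner ℝ W g) + 2 * (β * inner ℝ y g) := by
    rw [← real_inner_self_eq_norm_sq, hv]
    simp only [inner_add_left, inner_add_right, real_inner_smul_left, real_inner_smul_right]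
    rw [c1, c2, c3, n1, n2, n3]
    ring
  have hvq : inner ℝ v (-((α * s) • y + g + s ^ 2 • X) + (γ * s) • y + (γ * (-r * s ^ 2)) • W)
      = - γ * s * inner ℝ W (g + s ^ 2 • X) - inner ℝ y g - s ^ 2 * inner ℝ X y - β * ‖g‖ ^ 2
        - β * s ^ 2 * inner ℝ g X
        - (α - γ) * s * (γ * s * inner ℝ W y + ‖y‖ ^ 2 + β * inner ℝ y g)
        - γ * r * s ^ 2 * (γ * s * ‖W‖ ^ 2 + inner ℝ W y + β * inner ℝ W g) := by
    rw [hv]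
    simp only [inner_add_left, inner_add_right, real_inner_smul_left, real_inner_smul_right,
      inner_neg_right]
    rw [c1, c2, c3, n1, n2, n3, real_inner_comm y X]
    ring
  rw [hvq, hvv, c3]
  linarith

variable [CompleteSpace H]

namespace TikhonovFlow

variable {Φ : H → EReal} {α β t₀ : ℝ} {lam eps : ℝ → ℝ} {x : ℝ → H} {w : H}

theorem timeDeriv_eps_nonpos (h : TikhonovFlow Φ α β t₀ lam eps x w) {t : ℝ} :
    timeDeriv t₀ eps t ≤ 0 := h.eps_anti.derivWithin_nonpos

theorem timeDeriv_lam_nonneg (h : TikhonovFlow Φ α β t₀ lam eps x w) {t : ℝ} :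
    0 ≤ timeDeriv t₀ lam t := h.lam_mono.derivWithin_nonneg

/-- The dissipation inequality for the energy, at a time where all the derivatives exist. -/
theorem deriv_energy_add_le (h : TikhonovFlow Φ α β t₀ lam eps x w) {γ c κ s r t d τd ρd : ℝ}
    (hβ : 0 < β) (hγ : 0 < γ) (hγα : γ < α) (hc : 0 < c) (hκ : 0 < κ) (ht : t₀ < t)
    (hs : s = √(eps t)) (hrs : timeDeriv t₀ eps t = -2 * r * s ^ 3)
    (h0a : r ≤ 2 * γ - α + γ * β * r * s) (h0b : r ≤ α - γ - 2 * κ)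
    (h1 : 2 * γ * (α - γ) + γ / c - 1 ≤ 0)
    (h2 : 2 * β * s ^ 4 + (2 - γ * β * s) * (-2 * r * s ^ 3) ≤ 0)
    (hsmall : s * (2 * α * β ^ 2 + β ^ 2 * α ^ 2 / (2 * κ) + β ^ 2 / 2) ≤ β / 2)
    (hvel : HasDerivAt (timeDeriv t₀ x) (timeDeriv t₀ (timeDeriv t₀ x) t) t)
    (hgrad : HasDerivAt (fun s => gradient (moreauEnvelope Φ (lam s)) (x s))
      (timeDeriv t₀ (fun s => gradient (moreauEnvelope Φ (lam s)) (x s)) t) t)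
    (heq : timeDeriv t₀ (timeDeriv t₀ x) t + (α * √(eps t)) • timeDeriv t₀ x t
      + β • timeDeriv t₀ (fun s => gradient (moreauEnvelope Φ (lam s)) (x s)) t
      + gradient (moreauEnvelope Φ (lam t)) (x t) + eps t • x t = 0)
    (hτ : HasDerivAt (fun s => 1 / eps s + lam s) τd t)
    (hρ : HasDerivAt (fun s => lam s * eps s) ρd t)
    (hE : HasDerivAt (energy Φ β γ t₀ lam eps x) d t) :
    d + s * (r + α - γ) * energy Φ β γ t₀ lam eps x t
      ≤ 1 / 2 * ‖w‖ ^ 2 * (eps t ^ 2 * timeDeriv t₀ lam t - timeDeriv t₀ eps t)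
        + s * (γ ^ 2 / κ + γ ^ 2 * c / 2 + γ ^ 2 / 2)
          * (‖w‖ * (|τd| / (1 / eps t + lam t) + |ρd|)) ^ 2 := by
  have het := h.eps_pos t ht.le
  have hlt := h.lam_pos t ht.le
  have hs0 : 0 < s := hs ▸ Real.sqrt_pos.2 het
  have hss : eps t = s ^ 2 := by rw [hs, Real.sq_sqrt het.le]
  obtain ⟨g, hg⟩ : ∃ g, g = gradient (moreauEnvelope Φ (lam t)) (x t) := ⟨_, rfl⟩
  obtain ⟨y, hy⟩ : ∃ y, y = timeDeriv t₀ x t := ⟨_, rfl⟩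
  obtain ⟨z, hz⟩ : ∃ z, z = tikhonovPoint Φ (eps t) (lam t) := ⟨_, rfl⟩
  obtain ⟨v, hv⟩ : ∃ v, v = (γ * √(eps t)) • (x t - z) + y + β • g := ⟨_, rfl⟩
  obtain ⟨D, hD⟩ : ∃ D, D = tikhonovFun Φ (eps t) (lam t) (x t)
    - tikhonovFun Φ (eps t) (lam t) z := ⟨_, rfl⟩
  have hτ0 : 0 < 1 / eps t + lam t := by positivity
  have hr : 0 ≤ r := by
    have h3 := h.timeDeriv_eps_nonpos (t := t)
    rw [hrs] at h3
    by_contra! hcon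
    have : 0 < -r * s ^ 3 := by
      have : 0 < -r := by linarith
      positivity
    linarith
  have hd := h.deriv_energy_le hγ.le ht (hvel.add (hgrad.const_smul β)) hτ hρ hE hg hy hz hv
  -- The differential equation eliminates x'' together with β times the derivative of the gradient.
  have hq : timeDeriv t₀ (timeDeriv t₀ x) t
      + β • timeDeriv t₀ (fun s => gradient (moreauEnvelope Φ (lam s)) (x s)) t
      = -((α * s) • y + g + s ^ 2 • x t) := by
    rw [← hs, ← hg, ← hy, hss] at heq
    rw [← sub_eq_zero, ← heq]
    abel
  have hsd : timeDeriv t₀ eps t / (2 * √(eps t)) = -r * s ^ 2 := by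
    rw [hrs, ← hs]
    field_simp
  rw [hq, hsd, ← hs] at hd
  rw [← hs] at hv
  have hD0 : 0 ≤ D := by
    have h3 := tikhonovFun_growth h.exists_prox het hlt (x t)
    rw [← hz] at h3
    have : 0 ≤ eps t / 2 * ‖x t - z‖ ^ 2 := by positivity
    linarith
  -- Strong convexity of the regularized function tested at z; `hwg` below uses convexity of the
  -- envelope alone.
  have hwφ : D + s ^ 2 / 2 * ‖x t - z‖ ^ 2 ≤ inner ℝ (x t - z) (g + s ^ 2 • x t) := by
    have h3 := tikhonovFun_add_le h.exists_prox (eps t) hlt (x t) z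
    rw [← hg, hss, ← neg_sub (x t) z, inner_neg_right, norm_neg, real_inner_comm] at h3
    rw [hD, hss]
    linarith
  have hwg : D - s ^ 2 / 2 * (‖x t‖ ^ 2 - ‖z‖ ^ 2) ≤ inner ℝ (x t - z) g := by
    have h3 := moreauEnvelope_add_inner_le h.exists_prox hlt (x t) z
    rw [← hg, ← neg_sub (x t) z, inner_neg_right, real_inner_comm] at h3
    rw [hD, hss, tikhonovFun, tikhonovFun]
    linarith
  have hL : 0 ≤ ‖w‖ * (|τd| / (1 / eps t + lam t) + |ρd|) := by positivity
  have key := energy_rate_vector hβ hγ hγα hc hκ hs0 hr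
    (h.timeDeriv_lam_nonneg (t := t)) hL h0a h0b h1 h2
    hsmall hD0 hwφ hwg hv
  have hEt : energy Φ β γ t₀ lam eps x t = D + 1 / 2 * ‖v‖ ^ 2 := by
    rw [hv, hD, hs, hz, hy, hg]
    rfl
  have hLL : γ * s * ‖v‖ * (‖w‖ * (τd / (1 / eps t + lam t) + |ρd|))
      ≤ γ * s * ‖v‖ * (‖w‖ * (|τd| / (1 / eps t + lam t) + |ρd|)) := by
    gcongr
    exact le_abs_self _
  rw [hEt]
  have m1 : eps t * inner ℝ (x t) y = s ^ 2 * inner ℝ (x t) y := by rw [hss]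
  have m2 : timeDeriv t₀ eps t * ‖x t‖ ^ 2 = -2 * r * s ^ 3 * ‖x t‖ ^ 2 := by rw [hrs]
  rw [m1, m2] at hd
  linarith

end TikhonovFlow

end EnergyRate

/-! ### Integrating factor, comparison principle and forcing term. -/

section Asymptotics

variable {H : Type*} [NormedAddCommGroup H] [InnerProductSpace ℝ H] [CompleteSpace H]

/-- The derivative of `1 / √ε`. -/
noncomputable def invSqrtRate (t₀ : ℝ) (eps : ℝ → ℝ) (t : ℝ) : ℝ :=
  -timeDeriv t₀ eps t / (2 * √(eps t) ^ 3)

/-- The integrating factor `exp (k ∫ √ε) / √ε`, where `ε` is frozen to the left of `t₀`. -/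
noncomputable def integratingFactor (t₀ t₁ k : ℝ) (eps : ℝ → ℝ) (t : ℝ) : ℝ :=
  Real.exp (k * ∫ s in t₁..t, √(eps (max s t₀))) / √(eps t)

namespace TikhonovFlow

variable {Φ : H → EReal} {α β t₀ : ℝ} {lam eps : ℝ → ℝ} {x : ℝ → H} {w : H}

theorem timeDeriv_eps_eq (h : TikhonovFlow Φ α β t₀ lam eps x w) {t : ℝ} (ht : t₀ ≤ t) :
    timeDeriv t₀ eps t = -2 * invSqrtRate t₀ eps t * √(eps t) ^ 3 := by
  have hs := Real.sqrt_pos.2 (h.eps_pos t ht)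
  rw [invSqrtRate]
  field_simp

theorem invSqrtRate_nonneg (h : TikhonovFlow Φ α β t₀ lam eps x w) {t : ℝ} :
    0 ≤ invSqrtRate t₀ eps t := by
  have := h.timeDeriv_eps_nonpos (t := t)
  exact div_nonneg (by linarith) (by positivity)

theorem timeDeriv_inv_sqrt (h : TikhonovFlow Φ α β t₀ lam eps x w) {t : ℝ} (ht : t₀ < t) :
    timeDeriv t₀ (fun s => 1 / √(eps s)) t = invSqrtRate t₀ eps t := by
  have hs := Real.sqrt_pos.2 (h.eps_pos t ht.le)
  have h1 := (hasDerivAt_timeDeriv_of_contDiffOn h.eps_C1 ht).sqrt (h.eps_pos t ht.le).ne'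
  have h2 := h1.fun_inv hs.ne'
  simp only [one_div]
  rw [timeDeriv, derivWithin_of_mem_nhds (Ici_mem_nhds ht), h2.deriv, invSqrtRate]
  field_simp

theorem continuous_sqrt_max (h : TikhonovFlow Φ α β t₀ lam eps x w) :
    Continuous fun s => √(eps (max s t₀)) :=
  (h.eps_C1.continuousOn.comp_continuous (by fun_prop) fun s => le_max_right s t₀).sqrt

theorem hasDerivAt_integral_sqrt (h : TikhonovFlow Φ α β t₀ lam eps x w) (t₁ t : ℝ) :
    HasDerivAt (fun t => ∫ s in t₁..t, √(eps (max s t₀))) √(eps (max t t₀)) t :=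
  intervalIntegral.integral_hasDerivAt_right (h.continuous_sqrt_max.intervalIntegrable _ _)
    (h.continuous_sqrt_max.stronglyMeasurableAtFilter _ _) h.continuous_sqrt_max.continuousAt

theorem integratingFactor_pos (h : TikhonovFlow Φ α β t₀ lam eps x w) {t₁ k t : ℝ}
    (ht : t₀ ≤ t) : 0 < integratingFactor t₀ t₁ k eps t :=
  div_pos (Real.exp_pos _) (Real.sqrt_pos.2 (h.eps_pos t ht))

theorem integratingFactor_C1 (h : TikhonovFlow Φ α β t₀ lam eps x w) (t₁ k : ℝ) :
    ContDiffOn ℝ 1 (integratingFactor t₀ t₁ k eps) (Ici t₀) := by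
  have h1 : ContDiff ℝ 1 fun t => ∫ s in t₁..t, √(eps (max s t₀)) := by
    rw [contDiff_one_iff_deriv]
    refine ⟨fun t => (h.hasDerivAt_integral_sqrt t₁ t).differentiableAt, ?_⟩
    have : deriv (fun t => ∫ s in t₁..t, √(eps (max s t₀))) = fun t => √(eps (max t t₀)) :=
      funext fun t => (h.hasDerivAt_integral_sqrt t₁ t).deriv
    rw [this]
    exact h.continuous_sqrt_max
  exact ((contDiff_const.mul h1).exp.contDiffOn).div h.sqrt_C1
    fun t ht => (Real.sqrt_pos.2 (h.eps_pos t ht)).ne'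

theorem hasDerivAt_integratingFactor (h : TikhonovFlow Φ α β t₀ lam eps x w) (t₁ k : ℝ) {t : ℝ}
    (ht : t₀ < t) : HasDerivAt (integratingFactor t₀ t₁ k eps)
      (integratingFactor t₀ t₁ k eps t * (√(eps t) * (invSqrtRate t₀ eps t + k))) t := by
  have hs := Real.sqrt_pos.2 (h.eps_pos t ht.le)
  have h1 := (hasDerivAt_timeDeriv_of_contDiffOn h.eps_C1 ht).sqrt (h.eps_pos t ht.le).ne'
  have h2 := (((h.hasDerivAt_integral_sqrt t₁ t).const_mul k).exp).fun_div h1 hs.ne'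
  refine h2.congr_deriv ?_
  rw [integratingFactor, h.timeDeriv_eps_eq ht.le, max_eq_left ht.le]
  field_simp
  ring

theorem energy_nonneg (h : TikhonovFlow Φ α β t₀ lam eps x w) (γ : ℝ) {t : ℝ} (ht : t₀ ≤ t) :
    eps t / 2 * ‖x t - tikhonovPoint Φ (eps t) (lam t)‖ ^ 2 ≤ energy Φ β γ t₀ lam eps x t := by
  have h1 := tikhonovFun_growth h.exists_prox (h.eps_pos t ht) (h.lam_pos t ht) (x t)
  rw [energy]
  have : ∀ v : H, 0 ≤ 1 / 2 * ‖v‖ ^ 2 := fun v => by positivity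
  linarith [this ((γ * √(eps t)) • (x t - tikhonovPoint Φ (eps t) (lam t)) + timeDeriv t₀ x t
        + β • gradient (moreauEnvelope Φ (lam t)) (x t))]

/-- Comparison of the energy with a supersolution `ψ` of the dissipation inequality. -/
theorem energy_le_of_supersolution (h : TikhonovFlow Φ α β t₀ lam eps x w) {γ k t₁ T : ℝ}
    {ψ : ℝ → ℝ} (hψ : ContDiffOn ℝ 1 ψ (Ici t₀)) (hT : t₀ ≤ T)
    (hrate : ∀ᵐ t, T < t → ∀ d, HasDerivAt (energy Φ β γ t₀ lam eps x) d t →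
      d + √(eps t) * (invSqrtRate t₀ eps t + k) * energy Φ β γ t₀ lam eps x t
        ≤ √(eps t) * (invSqrtRate t₀ eps t + k) * ψ t + timeDeriv t₀ ψ t) :
    ∃ C, ∀ t, T ≤ t → energy Φ β γ t₀ lam eps x t ≤ ψ t + C / integratingFactor t₀ t₁ k eps t := by
  set Γ := integratingFactor t₀ t₁ k eps
  set E := energy Φ β γ t₀ lam eps x
  refine ⟨Γ T * (E T - ψ T), fun t ht => ?_⟩
  have hΓ : 0 < Γ t := h.integratingFactor_pos (hT.trans ht)
  have hEac := h.energy_ac γ hT ht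
  have hac := ((h.integratingFactor_C1 t₁ k).absolutelyContinuousOnInterval_of_Ici hT ht).fun_mul
    (hEac.fun_sub (hψ.absolutelyContinuousOnInterval_of_Ici hT ht))
  have hle : Γ t * (E t - ψ t) ≤ Γ T * (E T - ψ T) := by
    refine hac.le_of_ae_deriv_nonpos ht ?_
    filter_upwards [hrate, hEac.ae_differentiableAt] with s hs hsd hst d hd
    have hst0 : t₀ < s := hT.trans_lt hst.1
    have hEd := (hsd (by rw [uIcc_of_le ht]; exact Ioo_subset_Icc_self hst)).hasDerivAt
    have h1 := hs hst.1 _ hEd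
    have h2 := (h.hasDerivAt_integratingFactor t₁ k hst0).fun_mul
      (hEd.fun_sub (hasDerivAt_timeDeriv_of_contDiffOn hψ hst0))
    rw [hd.unique h2]
    have hΓs : 0 < Γ s := h.integratingFactor_pos hst0.le
    have h3 : Γ s * (√(eps s) * (invSqrtRate t₀ eps s + k)) * (E s - ψ s)
        + Γ s * (deriv E s - timeDeriv t₀ ψ s) = Γ s * (deriv E s
          + √(eps s) * (invSqrtRate t₀ eps s + k) * E s
          - (√(eps s) * (invSqrtRate t₀ eps s + k) * ψ s + timeDeriv t₀ ψ s)) := by ring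
    exact h3.trans_le (mul_nonpos_of_nonneg_of_nonpos hΓs.le (by linarith))
  have h1 : E t - ψ t ≤ Γ T * (E T - ψ T) / Γ t := by
    rw [le_div_iff₀ hΓ]
    linarith
  linarith

/-- The right-hand side of the dissipation inequality, divided by `ε ^ (3 / 2)`. -/
noncomputable def forcing (t₀ : ℝ) (lam eps : ℝ → ℝ) (M K t : ℝ) : ℝ :=
  M ^ 2 / 2 * (timeDeriv t₀ lam t * √(eps t) + 2 * invSqrtRate t₀ eps t)
    + K * M ^ 2 * (2 * (1 + lam t * eps t) * invSqrtRate t₀ eps t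
      + 2 * (timeDeriv t₀ lam t * √(eps t))) ^ 2

theorem ae_deriv_energy_add_le (h : TikhonovFlow Φ α β t₀ lam eps x w) {γ a c : ℝ}
    (hβ : 0 < β) (hγ : 0 < γ) (hγα : γ < α) (ha : 0 < a) (hc : 0 < c)
    (heps_lim : Tendsto eps atTop (𝓝 0))
    (h₀ : ∀ᶠ t in atTop, timeDeriv t₀ (fun s => 1 / √(eps s)) t ≤
      min (2 * γ - α - γ * β * timeDeriv t₀ eps t / (2 * eps t)) (α - γ * ((a + 1) / a)))
    (h₁ : ∀ᶠ t in atTop,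
      (2 * γ * (α - γ) + γ / c - 1) * eps t - β * timeDeriv t₀ eps t ≤ 0)
    (h₂ : ∀ᶠ t in atTop,
      2 * β * eps t ^ 2 + (2 - γ * β * √(eps t)) * timeDeriv t₀ eps t ≤ 0) :
    ∃ K T : ℝ, t₀ < T ∧ (∀ t, T ≤ t → invSqrtRate t₀ eps t ≤ α) ∧
      ∀ᵐ t, T < t → ∀ d, HasDerivAt (energy Φ β γ t₀ lam eps x) d t →
        d + √(eps t) * (invSqrtRate t₀ eps t + (α - γ)) * energy Φ β γ t₀ lam eps x t
          ≤ √(eps t) ^ 3 * forcing t₀ lam eps ‖w‖ K t := by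
  -- Chosen so that γ (a + 1) / a = γ + 2 κ, the Young parameter that `h0b` accommodates.
  set κ := γ / (2 * a) with hκdef
  have hκ : 0 < κ := by positivity
  have hsmall : ∀ᶠ t in atTop,
      √(eps t) * (2 * α * β ^ 2 + β ^ 2 * α ^ 2 / (2 * κ) + β ^ 2 / 2) ≤ β / 2 := by
    have := (heps_lim.sqrt).mul_const (2 * α * β ^ 2 + β ^ 2 * α ^ 2 / (2 * κ) + β ^ 2 / 2)
    rw [Real.sqrt_zero, zero_mul] at this
    exact this.eventually_le_const (by positivity)
  obtain ⟨T, hT⟩ := eventually_atTop.1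
    (((h₀.and h₁).and (h₂.and hsmall)).and (eventually_gt_atTop t₀))
  have hr : ∀ t, T ≤ t → invSqrtRate t₀ eps t
        ≤ 2 * γ - α + γ * β * invSqrtRate t₀ eps t * √(eps t) ∧
      invSqrtRate t₀ eps t ≤ α - γ - 2 * κ := by
    intro t ht
    obtain ⟨⟨⟨h0, -⟩, -⟩, htt⟩ := hT t ht
    have het := h.eps_pos t htt.le
    have hs := Real.sqrt_pos.2 het
    rw [h.timeDeriv_inv_sqrt htt, le_min_iff, h.timeDeriv_eps_eq htt.le] at h0
    have e1 : γ * β * (-2 * invSqrtRate t₀ eps t * √(eps t) ^ 3) / (2 * eps t)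
        = -(γ * β * invSqrtRate t₀ eps t * √(eps t)) := by
      have : eps t = √(eps t) ^ 2 := (Real.sq_sqrt het.le).symm
      rw [div_eq_iff (by positivity)]
      linear_combination (2 * γ * β * invSqrtRate t₀ eps t * √(eps t)) * this
    have e2 : γ * ((a + 1) / a) = γ + 2 * κ := by
      rw [hκdef]
      field_simp
    rw [e1, e2] at h0
    exact ⟨by linarith [h0.1], by linarith [h0.2]⟩
  refine ⟨γ ^ 2 / κ + γ ^ 2 * c / 2 + γ ^ 2 / 2, T, (hT T le_rfl).2,
    fun t ht => by linarith [(hr t ht).2], ?_⟩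
  have heq := (ae_restrict_iff' (measurableSet_Ici (a := t₀))).1 h.sol.equation
  filter_upwards [heq, h.sol.velocity_ac.ae_hasDerivAt, h.sol.gradient_ac.ae_hasDerivAt]
    with t hteq hvel hgrad ht d hd
  obtain ⟨⟨⟨-, h1⟩, h2, hsm⟩, htt⟩ := hT t ht.le
  have het := h.eps_pos t htt.le
  have hlt := h.lam_pos t htt.le
  have hs := Real.sqrt_pos.2 het
  have hss : eps t = √(eps t) ^ 2 := (Real.sq_sqrt het.le).symm
  have hed := h.timeDeriv_eps_eq htt.le
  have hnp := h.timeDeriv_eps_nonpos (t := t)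
  have hnn := h.timeDeriv_lam_nonneg (t := t)
  have hr0 := h.invSqrtRate_nonneg (t := t)
  have hdl := hasDerivAt_timeDeriv_of_contDiffOn h.lam_C1 htt
  have hde := hasDerivAt_timeDeriv_of_contDiffOn h.eps_C1 htt
  -- As -β ε' ≥ 0 and ε > 0, the hypothesis forces the constant coefficient itself to be
  -- nonpositive.
  have h1' : 2 * γ * (α - γ) + γ / c - 1 ≤ 0 := by
    by_contra! hcon
    have := mul_pos hcon het
    have := mul_nonpos_of_nonneg_of_nonpos hβ.le hnp
    linarith
  have h2' : 2 * β * √(eps t) ^ 4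
      + (2 - γ * β * √(eps t)) * (-2 * invSqrtRate t₀ eps t * √(eps t) ^ 3) ≤ 0 := by
    rw [← hed]
    have : √(eps t) ^ 4 = eps t ^ 2 := by
      nth_rewrite 2 [hss]
      ring
    rwa [this]
  have hτ : HasDerivAt (fun s => 1 / eps s + lam s)
      (-timeDeriv t₀ eps t / eps t ^ 2 + timeDeriv t₀ lam t) t := by
    simpa only [one_div] using (hde.fun_inv het.ne').fun_add hdl
  have hρ := hdl.fun_mul hde
  have key := h.deriv_energy_add_le hβ hγ hγα hc hκ htt rfl hed (hr t ht.le).1 (hr t ht.le).2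
    h1' h2' hsm (hvel htt) (hgrad htt) (hteq htt.le) hτ hρ hd
  rw [← add_sub_assoc]
  refine key.trans ?_
  set r := invSqrtRate t₀ eps t
  set s := √(eps t)
  set ld := timeDeriv t₀ lam t
  set ed := timeDeriv t₀ eps t
  -- Dropping λ from the denominator turns the index part into s (2r + λ' s); the scaling part is at
  -- most s (λ' s + 2 λ ε r).
  have hL : |-ed / eps t ^ 2 + ld| / (1 / eps t + lam t) + |ld * eps t + lam t * ed|
      ≤ s * (2 * (1 + lam t * eps t) * r + 2 * (ld * s)) := by
    have l1 : |-ed / eps t ^ 2 + ld| = -ed / eps t ^ 2 + ld :=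
      abs_of_nonneg (add_nonneg (div_nonneg (by linarith) (by positivity)) hnn)
    have l2 : |-ed / eps t ^ 2 + ld| / (1 / eps t + lam t)
        ≤ |-ed / eps t ^ 2 + ld| / (1 / eps t) := by
      gcongr
      linarith
    have l3 : |-ed / eps t ^ 2 + ld| / (1 / eps t) = s * (2 * r + ld * s) := by
      rw [l1, hed, hss]
      field_simp
    have l4 : |ld * eps t + lam t * ed| ≤ ld * eps t + lam t * (-ed) := by
      refine (abs_add_le _ _).trans ?_
      rw [abs_mul, abs_mul, abs_of_nonneg hnn, abs_of_pos het, abs_of_pos hlt, abs_of_nonpos hnp]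
    have l5 : ld * eps t + lam t * (-ed) = s * (ld * s + 2 * (lam t * eps t) * r) := by
      rw [hed, hss]
      ring
    calc _ ≤ s * (2 * r + ld * s) + s * (ld * s + 2 * (lam t * eps t) * r) := by
          rw [← l3, ← l5]
          exact add_le_add l2 l4
      _ = _ := by ring
  have hL0 : 0 ≤ |-ed / eps t ^ 2 + ld| / (1 / eps t + lam t) + |ld * eps t + lam t * ed| := by
    positivity
  calc _ ≤ 1 / 2 * ‖w‖ ^ 2 * (eps t ^ 2 * ld - ed)
        + s * (γ ^ 2 / κ + γ ^ 2 * c / 2 + γ ^ 2 / 2)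
          * (‖w‖ * (s * (2 * (1 + lam t * eps t) * r + 2 * (ld * s)))) ^ 2 := by
        gcongr
    _ = _ := by
        rw [forcing, hed]
        nth_rewrite 1 [hss]
        ring

end TikhonovFlow

end Asymptotics

/-! ### Passage to the limit. -/

section Limits

variable {H : Type*} [NormedAddCommGroup H] [InnerProductSpace ℝ H] [CompleteSpace H]

theorem rpow_three_halves {e : ℝ} (he : 0 ≤ e) : e ^ (3 / 2 : ℝ) = √e ^ 3 := by
  rw [Real.sqrt_eq_rpow, ← Real.rpow_natCast, ← Real.rpow_mul he]
  norm_num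

theorem tendsto_zero_of_le_add {ι : Type*} {l : Filter ι} {f : ι → ℝ}
    (hf : ∀ᶠ i in l, 0 ≤ f i)
    (h : ∀ δ > 0, ∃ g : ι → ℝ, Tendsto g l (𝓝 0) ∧ ∀ᶠ i in l, f i ≤ δ + g i) :
    Tendsto f l (𝓝 0) := by
  rw [Metric.tendsto_nhds]
  intro ε hε
  obtain ⟨g, hg, hfg⟩ := h (ε / 2) (by positivity)
  filter_upwards [hf, hfg, hg.eventually_lt_const (show (0 : ℝ) < ε / 2 by positivity)]
    with i h1 h2 h3
  rw [Real.dist_eq, sub_zero, abs_of_nonneg h1]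
  linarith

namespace TikhonovFlow

variable {Φ : H → EReal} {α β t₀ : ℝ} {lam eps : ℝ → ℝ} {x : ℝ → H} {w : H}

theorem integratingFactor_eq {t₁ k t : ℝ} (ht₁ : t₀ ≤ t₁)
    (ht : t₁ ≤ t) : integratingFactor t₀ t₁ k eps t
      = Real.exp (k * ∫ s in t₁..t, √(eps s)) / √(eps t) := by
  rw [integratingFactor]
  congr 3
  refine intervalIntegral.integral_congr fun s hs => ?_
  rw [uIcc_of_le ht] at hs
  simp only [max_eq_left (ht₁.trans hs.1)]

/-- The exponential is at least 1, so the factor dominates 1/√ε; divergence of ∫ √ε is not required.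
-/
theorem tendsto_integratingFactor (h : TikhonovFlow Φ α β t₀ lam eps x w) {k : ℝ} (hk : 0 ≤ k)
    (heps_lim : Tendsto eps atTop (𝓝 0)) :
    Tendsto (integratingFactor t₀ t₀ k eps) atTop atTop := by
  have h1 : Tendsto (fun t => (√(eps t))⁻¹) atTop atTop := by
    refine Tendsto.inv_tendsto_nhdsGT_zero ?_
    refine tendsto_nhdsWithin_iff.2 ⟨by simpa using heps_lim.sqrt, ?_⟩
    filter_upwards [eventually_ge_atTop t₀] with t ht using Real.sqrt_pos.2 (h.eps_pos t ht)
  refine tendsto_atTop_mono' _ ?_ h1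
  filter_upwards [eventually_ge_atTop t₀] with t ht
  rw [integratingFactor, ← one_div]
  gcongr
  refine Real.one_le_exp (mul_nonneg hk ?_)
  exact intervalIntegral.integral_nonneg ht fun s _ => Real.sqrt_nonneg _

theorem tendsto_energy (h : TikhonovFlow Φ α β t₀ lam eps x w) {γ K T : ℝ}
    (hγα : γ < α) (heps_lim : Tendsto eps atTop (𝓝 0))
    (hlameps : Tendsto (fun t => lam t * eps t) atTop (𝓝 0)) (hT : t₀ < T)
    (hbdd : ∀ t, T ≤ t → invSqrtRate t₀ eps t ≤ α)
    (hrate : ∀ᵐ t, T < t → ∀ d, HasDerivAt (energy Φ β γ t₀ lam eps x) d t →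
        d + √(eps t) * (invSqrtRate t₀ eps t + (α - γ)) * energy Φ β γ t₀ lam eps x t
          ≤ √(eps t) ^ 3 * forcing t₀ lam eps ‖w‖ K t)
    (hl₁ : Tendsto (fun t => timeDeriv t₀ lam t * eps t ^ (3 / 2 : ℝ)) atTop (𝓝 0))
    (hl₂ : Tendsto (fun t => timeDeriv t₀ lam t / lam t) atTop (𝓝 0)) :
    Tendsto (energy Φ β γ t₀ lam eps x) atTop (𝓝 0) := by
  have hs0 : Tendsto (fun t => √(eps t)) atTop (𝓝 0) := by simpa using heps_lim.sqrt
  have hrs : Tendsto (fun t => invSqrtRate t₀ eps t * √(eps t)) atTop (𝓝 0) := by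
    refine squeeze_zero' ?_ ?_ (by simpa using hs0.const_mul α)
    · exact Eventually.of_forall fun t => mul_nonneg h.invSqrtRate_nonneg (Real.sqrt_nonneg _)
    · filter_upwards [eventually_ge_atTop T] with t ht
      exact mul_le_mul_of_nonneg_right (hbdd t ht) (Real.sqrt_nonneg _)
  -- λ' ε = (λ'/λ)(λ ε).
  have hle : Tendsto (fun t => timeDeriv t₀ lam t * √(eps t) ^ 2) atTop (𝓝 0) := by
    refine (by simpa using hl₂.mul hlameps : Tendsto _ _ (𝓝 (0 : ℝ))).congr' ?_
    filter_upwards [eventually_ge_atTop t₀] with t ht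
    have := h.lam_pos t ht
    rw [Real.sq_sqrt (h.eps_pos t ht).le]
    field_simp
  have hl₁' : Tendsto (fun t => timeDeriv t₀ lam t * √(eps t) ^ 3) atTop (𝓝 0) := by
    refine hl₁.congr' ?_
    filter_upwards [eventually_ge_atTop t₀] with t ht
    rw [rpow_three_halves (h.eps_pos t ht).le]
  have hforce : Tendsto (fun t => √(eps t) ^ 2 * forcing t₀ lam eps ‖w‖ K t) atTop (𝓝 0) := by
    have h1 := ((hl₁'.add ((hrs.mul hs0).const_mul 2)).const_mul (‖w‖ ^ 2 / 2)).add
      ((((((hlameps.const_add 1).const_mul 2).mul hrs).add (hle.const_mul 2)).pow 2).const_mul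
        (K * ‖w‖ ^ 2))
    norm_num at h1
    refine h1.congr fun t => ?_
    rw [forcing]
    ring
  have hΓ := h.tendsto_integratingFactor (sub_nonneg.2 hγα.le) heps_lim
  refine tendsto_zero_of_le_add ?_ fun δ hδ => ?_
  · filter_upwards [eventually_ge_atTop t₀] with t ht
    have := h.eps_pos t ht
    exact le_trans (by positivity) (h.energy_nonneg γ ht)
  have hev := hforce.eventually_le_const (show 0 < (α - γ) * δ from mul_pos (by linarith) hδ)
  obtain ⟨T', hT'⟩ := eventually_atTop.1 (hev.and (eventually_ge_atTop T))
  have hT₀ : T ≤ T' := (hT' T' le_rfl).2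
  -- The constant δ is a supersolution as soon as ε F ≤ (α - γ) δ, since r ≥ 0.
  obtain ⟨C, hC⟩ := h.energy_le_of_supersolution (γ := γ) (k := α - γ) (t₁ := t₀) (T := T')
    (ψ := fun _ => δ) contDiffOn_const (hT.le.trans hT₀) (by
      filter_upwards [hrate] with t ht htt d hd
      refine (ht (hT₀.trans_lt htt) d hd).trans ?_
      have h1 := (hT' t htt.le).1
      have h2 : timeDeriv t₀ (fun _ : ℝ => δ) t = 0 := by simp [timeDeriv]
      have h3 := h.invSqrtRate_nonneg (t := t)
      rw [h2]
      calc _ = √(eps t) * (√(eps t) ^ 2 * forcing t₀ lam eps ‖w‖ K t) := by ring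
        _ ≤ √(eps t) * ((α - γ) * δ) := by gcongr
        _ ≤ √(eps t) * ((invSqrtRate t₀ eps t + (α - γ)) * δ) := by
          gcongr
          linarith
        _ = _ := by ring)
  refine ⟨_, hΓ.const_div_atTop C, ?_⟩
  filter_upwards [eventually_ge_atTop T'] with t ht using hC t ht

theorem tendsto_energy_div (h : TikhonovFlow Φ α β t₀ lam eps x w) {γ K T t₁ : ℝ}
    (hγα : γ < α) (hlameps : Tendsto (fun t => lam t * eps t) atTop (𝓝 0)) (hT : t₀ < T)
    (hrate : ∀ᵐ t, T < t → ∀ d, HasDerivAt (energy Φ β γ t₀ lam eps x) d t →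
        d + √(eps t) * (invSqrtRate t₀ eps t + (α - γ)) * energy Φ β γ t₀ lam eps x t
          ≤ √(eps t) ^ 3 * forcing t₀ lam eps ‖w‖ K t)
    (ht₁ : t₀ ≤ t₁)
    (hexp : Tendsto (fun t => √(eps t) * Real.exp ((α - γ) * ∫ s in t₁..t, √(eps s)))
      atTop atTop)
    (hdeps : Tendsto (fun t => timeDeriv t₀ eps t / eps t ^ (3 / 2 : ℝ)) atTop (𝓝 0))
    (hdlam : Tendsto (fun t => timeDeriv t₀ lam t * √(eps t)) atTop (𝓝 0)) :
    Tendsto (fun t => energy Φ β γ t₀ lam eps x t / eps t) atTop (𝓝 0) := by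
  have hr : Tendsto (fun t => invSqrtRate t₀ eps t) atTop (𝓝 0) := by
    refine (by simpa using hdeps.const_mul (-1 / 2) : Tendsto _ _ (𝓝 (0 : ℝ))).congr' ?_
    filter_upwards [eventually_ge_atTop t₀] with t ht
    rw [rpow_three_halves (h.eps_pos t ht).le, invSqrtRate]
    ring
  have hforce : Tendsto (fun t => forcing t₀ lam eps ‖w‖ K t) atTop (𝓝 0) := by
    have h1 := ((hdlam.add (hr.const_mul 2)).const_mul (‖w‖ ^ 2 / 2)).add
      ((((((hlameps.const_add 1).const_mul 2).mul hr).add (hdlam.const_mul 2)).pow 2).const_mul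
        (K * ‖w‖ ^ 2))
    norm_num at h1
    exact h1
  refine tendsto_zero_of_le_add ?_ fun δ hδ => ?_
  · filter_upwards [eventually_ge_atTop t₀] with t ht
    have := h.eps_pos t ht
    exact div_nonneg (le_trans (by positivity) (h.energy_nonneg γ ht)) this.le
  have hlim : Tendsto (fun t => forcing t₀ lam eps ‖w‖ K t + δ * invSqrtRate t₀ eps t) atTop
      (𝓝 0) := by simpa using hforce.add (hr.const_mul δ)
  have hev := hlim.eventually_le_const (show 0 < (α - γ) * δ from mul_pos (by linarith) hδ)
  obtain ⟨T', hT'⟩ := eventually_atTop.1 (hev.and (eventually_ge_atTop T))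
  have hT₀ : T ≤ T' := (hT' T' le_rfl).2
  -- For ψ = δ ε the supersolution side is s³ δ (α - γ - r), hence the requirement F + δ r ≤ (α - γ)
  -- δ.
  obtain ⟨C, hC⟩ := h.energy_le_of_supersolution (γ := γ) (k := α - γ) (t₁ := t₁) (T := T')
    (ψ := fun t => δ * eps t) (contDiffOn_const.mul h.eps_C1) (hT.le.trans hT₀) (by
      filter_upwards [hrate] with t ht htt d hd
      refine (ht (hT₀.trans_lt htt) d hd).trans ?_
      have htt₀ : t₀ < t := hT.trans (hT₀.trans_lt htt)
      have h1 := (hT' t htt.le).1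
      have h2 : timeDeriv t₀ (fun t => δ * eps t) t
          = δ * (-2 * invSqrtRate t₀ eps t * √(eps t) ^ 3) := by
        rw [← h.timeDeriv_eps_eq htt₀.le, timeDeriv, derivWithin_of_mem_nhds (Ici_mem_nhds htt₀),
          ((hasDerivAt_timeDeriv_of_contDiffOn h.eps_C1 htt₀).const_mul δ).deriv]
      have h3 : eps t = √(eps t) ^ 2 := (Real.sq_sqrt (h.eps_pos t htt₀.le).le).symm
      rw [h2]
      calc _ ≤ √(eps t) ^ 3 * ((α - γ) * δ - δ * invSqrtRate t₀ eps t) := by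
            gcongr
            linarith
        _ = √(eps t) * (invSqrtRate t₀ eps t + (α - γ)) * (δ * √(eps t) ^ 2)
            + δ * (-2 * invSqrtRate t₀ eps t * √(eps t) ^ 3) := by ring
        _ = _ := by rw [← h3])
  refine ⟨_, hexp.const_div_atTop C, ?_⟩
  filter_upwards [eventually_ge_atTop T', eventually_ge_atTop t₁] with t ht htt₁
  have h1 := hC t ht
  have het := h.eps_pos t (ht₁.trans htt₁)
  have hs := Real.sqrt_pos.2 het
  rw [integratingFactor_eq ht₁ htt₁] at h1
  rw [div_le_iff₀ het]
  refine h1.trans (le_of_eq ?_)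
  rw [add_mul]
  congr 1
  have h3 : eps t = √(eps t) ^ 2 := (Real.sq_sqrt het.le).symm
  set I := ∫ s in t₁..t, √(eps s)
  have h4 : C / (√(eps t) * Real.exp ((α - γ) * I)) * eps t
      = C / (√(eps t) * Real.exp ((α - γ) * I)) * √(eps t) ^ 2 := by rw [← h3]
  rw [h4]
  field_simp

/-- The index 1/ε + λ tends to infinity and the scaling 1 / (1 + λ ε) to 1, so z inherits the limit
of the proximal path. -/
theorem tendsto_tikhonovPoint (h : TikhonovFlow Φ α β t₀ lam eps x w)
    (hproper : IsProperFun Φ) (hlsc : LowerSemicontinuous Φ)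
    (heps_lim : Tendsto eps atTop (𝓝 0))
    (hlameps : Tendsto (fun t => lam t * eps t) atTop (𝓝 0)) :
    ∃ xs, IsMinNormMinimizer Φ xs ∧
      Tendsto (fun t => tikhonovPoint Φ (eps t) (lam t)) atTop (𝓝 xs) := by
  have hex : ∀ τ : ℝ, ∃ P, 0 < τ → IsProx Φ τ 0 P := fun τ => by
    by_cases hτ : 0 < τ
    · obtain ⟨P, hP⟩ := h.exists_prox τ hτ 0
      exact ⟨P, fun _ => hP⟩
    · exact ⟨0, fun h => absurd h hτ⟩
  choose P hP using hex
  obtain ⟨xs, hxs, hlim⟩ := exists_isMinNormMinimizer_tendsto hproper hlsc ⟨w, h.mem_argmin⟩ hP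
  refine ⟨xs, hxs, ?_⟩
  have hτ : Tendsto (fun t => 1 / eps t + lam t) atTop atTop := by
    have h1 : Tendsto (fun t => (eps t)⁻¹) atTop atTop := by
      refine Tendsto.inv_tendsto_nhdsGT_zero (tendsto_nhdsWithin_iff.2 ⟨heps_lim, ?_⟩)
      filter_upwards [eventually_ge_atTop t₀] with t ht using h.eps_pos t ht
    refine tendsto_atTop_mono' _ ?_ h1
    filter_upwards [eventually_ge_atTop t₀] with t ht
    rw [one_div]
    linarith [h.lam_pos t ht]
  have h2 : Tendsto (fun t => (1 / (1 + lam t * eps t)) • P (1 / eps t + lam t)) atTop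
      (𝓝 ((1 / (1 + 0) : ℝ) • xs)) :=
    (tendsto_const_nhds.div (hlameps.const_add 1) (by norm_num)).smul (hlim.comp hτ)
  rw [add_zero, div_one, one_smul] at h2
  refine h2.congr' ?_
  filter_upwards [eventually_ge_atTop t₀] with t ht
  have he := h.eps_pos t ht
  have hl := h.lam_pos t ht
  exact (tikhonovPoint_eq h.exists_prox he hl (hP _ (by positivity))).symm

theorem tendsto_trajectory (h : TikhonovFlow Φ α β t₀ lam eps x w) {γ : ℝ}
    (hE : Tendsto (fun t => energy Φ β γ t₀ lam eps x t / eps t) atTop (𝓝 0)) {xs : H}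
    (hz : Tendsto (fun t => tikhonovPoint Φ (eps t) (lam t)) atTop (𝓝 xs)) :
    Tendsto x atTop (𝓝 xs) := by
  have h1 : Tendsto (fun t => ‖x t - tikhonovPoint Φ (eps t) (lam t)‖) atTop (𝓝 0) := by
    have h2 : Tendsto (fun t => √(2 * (energy Φ β γ t₀ lam eps x t / eps t))) atTop (𝓝 0) := by
      simpa using (hE.const_mul 2).sqrt
    refine squeeze_zero' (Eventually.of_forall fun t => norm_nonneg _) ?_ h2
    filter_upwards [eventually_ge_atTop t₀] with t ht
    have he := h.eps_pos t ht
    have h3 := h.energy_nonneg γ ht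
    refine Real.le_sqrt_of_sq_le ?_
    rw [← mul_div_assoc, le_div_iff₀ he]
    linarith
  have h2 := (tendsto_zero_iff_norm_tendsto_zero.2 h1).add hz
  simpa using h2

end TikhonovFlow

end Limits

/-! ### Assembly of the two conclusions. -/

theorem mainTheorem5 {H : Type*} [NormedAddCommGroup H] [InnerProductSpace ℝ H] [CompleteSpace H]
    (Φ : H → EReal) (hproper : IsProperFun Φ) (hconv : IsConvexFun Φ)
    (hlsc : LowerSemicontinuous Φ) (hargmin : (argminSet Φ).Nonempty)
    (α β t₀ : ℝ) (hα : 0 < α) (hβ : 0 < β) (ht₀ : 0 < t₀)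
    (lam eps : ℝ → ℝ)
    (hlam_pos : ∀ t, t₀ ≤ t → 0 < lam t) (hlam_C1 : ContDiffOn ℝ 1 lam (Ici t₀))
    (hlam_mono : MonotoneOn lam (Ici t₀))
    (heps_pos : ∀ t, t₀ ≤ t → 0 < eps t) (heps_C1 : ContDiffOn ℝ 1 eps (Ici t₀))
    (heps_anti : AntitoneOn eps (Ici t₀)) (heps_lim : Tendsto eps atTop (𝓝 0))
    (x : ℝ → H) (hx : IsStrongSolution Φ α β t₀ lam eps x)
    (γ : ℝ) (hγ₁ : α / 2 ≤ γ) (hγ₂ : γ < α)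
    (hlameps : Tendsto (fun t => lam t * eps t) atTop (𝓝 0))
    (a c : ℝ) (ha : 0 < a) (hc : 0 < c)
    (h₀ : ∀ᶠ t in atTop, timeDeriv t₀ (fun s => 1 / √(eps s)) t ≤
      min (2 * γ - α - γ * β * timeDeriv t₀ eps t / (2 * eps t)) (α - γ * ((a + 1) / a)))
    (h₁ : ∀ᶠ t in atTop,
      (2 * γ * (α - γ) + γ / c - 1) * eps t - β * timeDeriv t₀ eps t ≤ 0)
    (h₂ : ∀ᶠ t in atTop,
      2 * β * eps t ^ 2 + (2 - γ * β * √(eps t)) * timeDeriv t₀ eps t ≤ 0)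
    (h₃ : ∀ᶠ t in atTop,
      (γ / a + 2 * (α - γ)) * β ^ 2 * √(eps t)
        - 3 * β ^ 2 * timeDeriv t₀ eps t / (2 * eps t) - timeDeriv t₀ lam t ≤ β) :
    (Tendsto (fun t => timeDeriv t₀ lam t * eps t ^ (3 / 2 : ℝ)) atTop (𝓝 0) →
      Tendsto (fun t => timeDeriv t₀ lam t / lam t) atTop (𝓝 0) →
        Tendsto (energy Φ β γ t₀ lam eps x) atTop (𝓝 0)) ∧
    (∀ t₁, t₀ ≤ t₁ →
      Tendsto (fun t => √(eps t) * Real.exp ((α - γ) * ∫ s in t₁..t, √(eps s))) atTop atTop →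
      Tendsto (fun t => timeDeriv t₀ eps t / eps t ^ (3 / 2 : ℝ)) atTop (𝓝 0) →
      Tendsto (fun t => timeDeriv t₀ lam t * √(eps t)) atTop (𝓝 0) →
      Tendsto (fun t => timeDeriv t₀ lam t / (lam t * √(eps t))) atTop (𝓝 0) →
        Tendsto (fun t => energy Φ β γ t₀ lam eps x t / eps t) atTop (𝓝 0) ∧
        (∃ xs : H, IsMinNormMinimizer Φ xs ∧ Tendsto x atTop (𝓝 xs)) ∧
        Tendsto (fun t => lam t * energy Φ β γ t₀ lam eps x t) atTop (𝓝 0)) := by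
  obtain ⟨w, hw⟩ := hargmin
  have hγ : 0 < γ := by linarith
  have h : TikhonovFlow Φ α β t₀ lam eps x w :=
    ⟨fun l hl y => exists_isProx hproper hconv hlsc ⟨w, hw⟩ hl y, hw, hlam_pos, hlam_C1, hlam_mono,
      heps_pos, heps_C1, heps_anti, hx⟩
  obtain ⟨K, T, hT, hbdd, hrate⟩ :=
    h.ae_deriv_energy_add_le hβ hγ hγ₂ ha hc heps_lim h₀ h₁ h₂
  refine ⟨fun hl₁ hl₂ => h.tendsto_energy hγ₂ heps_lim hlameps hT hbdd hrate hl₁ hl₂,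
    fun t₁ ht₁ hexp hdeps hdlam _ => ?_⟩
  have hE := h.tendsto_energy_div hγ₂ hlameps hT hrate ht₁ hexp hdeps hdlam
  obtain ⟨xs, hxs, hz⟩ := h.tendsto_tikhonovPoint hproper hlsc heps_lim hlameps
  refine ⟨hE, ⟨xs, hxs, h.tendsto_trajectory hE hz⟩, ?_⟩
  refine (by simpa using hlameps.mul hE : Tendsto _ _ (𝓝 (0 : ℝ))).congr' ?_
  filter_upwards [eventually_ge_atTop t₀] with t ht
  have := heps_pos t ht
  field_simp
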